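/- Let $L$ be a countable relational language. We consider formulas of $\mathcal{L}_{\omega_1\omega}$ (with equality, finitely many free variables, countable $\bigwedge$ and $\bigvee$, finite blocks of quantifiers $\exists\bar y$, $\forall\bar y$, possibly empty). For countable ordinals $\alpha$: a formula is $\Sigma_0$, equivalently $\Pi_0$, if it is finitary quantifier-free; for $\alpha>0$ it is $\Sigma_\alpha$ if it has the form $\bigvee_i\exists\bar y_i\,\psi_i$ with each $\psi_i$ in $\Pi_\beta$ for some $\beta<\alpha$, and $\Pi_\alpha$ if it has the form $\bigwedge_i\forall\bar y_i\,\psi_i$ with each $\psi_i$ in $\Sigma_\beta$ for some $\beta<\alpha$. For $1\le\alpha<\omega_1$ define classes of formulas by simultaneous recursion: $\mathfrak{E}_1=\Sigma_1$ and $\mathfrak{A}_1=\Pi_1$; for $\alpha>1$, $\mathfrak{E}_\alpha$ is the closure of $\bigcup_{1\le\beta<\alpha}\overline{\mathfrak{A}}_\beta$ under $\exists$ and countable $\bigvee$, and $\mathfrak{A}_\alpha$ is the closure of $\bigcup_{1\le\beta<\alpha}\overline{\mathfrak{E}}_\beta$ under $\forall$ and countable $\bigwedge$; for all $\alpha\ge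 1$, $\overline{\mathfrak{E}}_\alpha$ and $\overline{\mathfrak{A}}_\alpha$ are the closures of $\mathfrak{E}_\alpha$ and $\mathfrak{A}_\alpha$, respectively, under countable $\bigvee$ and countable $\bigwedge$. A formula is $\forall\mathfrak{E}_\alpha$ if it has the form $\bigwedge_{i\in\omega}\forall\bar y_i\,\psi_i$ with every $\psi_i\in\mathfrak{E}_\alpha$. A Scott sentence of a countable $L$-structure $\mathcal M$ is a sentence $\varphi$ of $\mathcal{L}_{\omega_1\omega}$ such that for every countable $L$-structure $\mathcal N$, $\mathcal N\models\varphi$ if and only if $\mathcal N\cong\mathcal M$. The Scott rank $\mathrm{SR}(\mathcal M)$ is the least $\alpha$ such that $\mathcal M$ has a $\Pi_{\alpha+1}$ Scott sentence. The $\mathfrak{A}_\alpha$-type of a tuple $\bar a$ of $\mathcal M$ is the set of all $\mathfrak{A}_\alpha$ formulas true of $\bar a$ in $\mathcal M$. A formula $\varphi(\bar x)$ supports a set $p(\bar x)$ of formulas in $\mathcal M$ if $\mathcal M\models\exists\bar x\,\varphi(\bar x)$ and $\mathcal M\models\forall\bar x\,(\varphi(\bar x)\to\psi(\bar x))$ for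 every $\psi\in p$. Theorem. Let $\mathcal M$ be a countable $L$-structure and let $1\le\alpha<\omega_1$. The following are equivalent: 1. $\mathcal M$ has a $\forall\mathfrak{E}_\alpha$ Scott sentence. 2. The $\mathfrak{A}_\alpha$-type of every finite tuple of $\mathcal M$ is supported in $\mathcal M$ by an $\mathfrak{E}_\alpha$ formula. 3. For every finite tuple $\bar a$ of $\mathcal M$, the orbit of $\bar a$ under the automorphism group of $\mathcal M$ is defined in $\mathcal M$, without parameters, by an $\mathfrak{E}_\alpha$ formula. 4. $\mathcal M$ has a $\Pi_{\alpha+1}$ Scott sentence. 5. $\mathrm{SR}(\mathcal M)\le\alpha$. -/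

import Mathlib

open FirstOrder

universe u v w

/-- Formulas of the infinitary logic `L_{ω₁ω}` (with equality) over a relational language `L`, with
free variables among `x₀, …, x_{n-1}`.  As the language is relational, its terms are exactly the
variables.  Conjunctions and disjunctions are countable; the quantifiers bind the last variable. -/
inductive InfFormula (L : FirstOrder.Language.{u, v}) : ℕ → Type v
  | falsum {n : ℕ} : InfFormula L n
  | equal {n : ℕ} (i j : Fin n) : InfFormula L n
  | rel {n k : ℕ} (R : L.Relations k) (t : Fin k → Fin n) : InfFormula L n
  | imp {n : ℕ} (φ ψ : InfFormula L n) : InfFormula L n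
  | iInf {n : ℕ} (φ : ℕ → InfFormula L n) : InfFormula L n
  | iSup {n : ℕ} (φ : ℕ → InfFormula L n) : InfFormula L n
  | all {n : ℕ} (φ : InfFormula L (n + 1)) : InfFormula L n
  | ex {n : ℕ} (φ : InfFormula L (n + 1)) : InfFormula L n

namespace InfFormula

variable {L : FirstOrder.Language.{u, v}}

/-- Satisfaction of a formula at a tuple of a structure. -/
def Realize {M : Type w} [L.Structure M] : {n : ℕ} → InfFormula L n → (Fin n → M) → Prop
  | _, falsum, _ => False
  | _, equal i j, a => a i = a j
  | _, rel R t, a => Language.Structure.RelMap R (fun m => a (t m))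
  | _, imp φ ψ, a => φ.Realize a → ψ.Realize a
  | _, iInf φ, a => ∀ i, (φ i).Realize a
  | _, iSup φ, a => ∃ i, (φ i).Realize a
  | n, all φ, a => ∀ x : M, φ.Realize (Fin.snoc a x : Fin (n + 1) → M)
  | n, ex φ, a => ∃ x : M, φ.Realize (Fin.snoc a x : Fin (n + 1) → M)

/-- `∃ ȳ φ` for a tuple `ȳ` of `k` variables. -/
def exs {n : ℕ} : (k : ℕ) → InfFormula L (n + k) → InfFormula L n
  | 0, φ => φ
  | k + 1, φ => exs k (ex φ)

/-- `∀ ȳ φ` for a tuple `ȳ` of `k` variables. -/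
def alls {n : ℕ} : (k : ℕ) → InfFormula L (n + k) → InfFormula L n
  | 0, φ => φ
  | k + 1, φ => alls k (all φ)

/-- Finitary quantifier-free formulas. -/
inductive IsQF : {n : ℕ} → InfFormula L n → Prop
  | falsum {n : ℕ} : IsQF (falsum : InfFormula L n)
  | equal {n : ℕ} (i j : Fin n) : IsQF (equal i j : InfFormula L n)
  | rel {n k : ℕ} (R : L.Relations k) (t : Fin k → Fin n) : IsQF (rel R t)
  | imp {n : ℕ} {φ ψ : InfFormula L n} (hφ : IsQF φ) (hψ : IsQF ψ) : IsQF (imp φ ψ)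

mutual

/-- The `Σ_α` formulas: for `α = 0` the finitary quantifier-free ones, for `α > 0` those of the form
`⋁ᵢ ∃ȳᵢ ψᵢ` where each `ψᵢ` is `Π_β` for some `β < α`. -/
inductive IsSigma : Ordinal.{0} → {n : ℕ} → InfFormula L n → Prop
  | qf {n : ℕ} {φ : InfFormula L n} (h : IsQF φ) : IsSigma 0 φ
  | iSup_exs {α : Ordinal.{0}} {n : ℕ} (k : ℕ → ℕ) (ψ : (i : ℕ) → InfFormula L (n + k i))
      (β : ℕ → Ordinal.{0}) (hβ : ∀ i, β i < α) (h : ∀ i, IsPi (β i) (ψ i)) :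
      IsSigma α (iSup fun i => exs (k i) (ψ i))

/-- The `Π_α` formulas: for `α = 0` the finitary quantifier-free ones, for `α > 0` those of the form
`⋀ᵢ ∀ȳᵢ ψᵢ` where each `ψᵢ` is `Σ_β` for some `β < α`. -/
inductive IsPi : Ordinal.{0} → {n : ℕ} → InfFormula L n → Prop
  | qf {n : ℕ} {φ : InfFormula L n} (h : IsQF φ) : IsPi 0 φ
  | iInf_alls {α : Ordinal.{0}} {n : ℕ} (k : ℕ → ℕ) (ψ : (i : ℕ) → InfFormula L (n + k i))
      (β : ℕ → Ordinal.{0}) (hβ : ∀ i, β i < α) (h : ∀ i, IsSigma (β i) (ψ i)) :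
      IsPi α (iInf fun i => alls (k i) (ψ i))

end

/-! The back-and-forth complexity classes, for ordinals `α ≥ 1` (all four are empty at `α = 0`, so
that below an ordinal `β < α` contributes only if `β ≥ 1`). -/

mutual

/-- The class `𝔈_α`: for `α = 1` the `Σ_1` formulas, for `α > 1` the closure of the `𝔄̄_β`, `β < α`,
under `∃` and countable disjunction. -/
inductive IsE : Ordinal.{0} → {n : ℕ} → InfFormula L n → Prop
  | sigma_one {n : ℕ} {φ : InfFormula L n} (h : IsSigma 1 φ) : IsE 1 φ
  | of_lt {α β : Ordinal.{0}} {n : ℕ} {φ : InfFormula L n} (hβ : β < α) (h : IsABar β φ) :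
      IsE α φ
  | ex {α : Ordinal.{0}} {n : ℕ} {φ : InfFormula L (n + 1)} (hα : 1 < α) (h : IsE α φ) :
      IsE α (ex φ)
  | iSup {α : Ordinal.{0}} {n : ℕ} {φ : ℕ → InfFormula L n} (hα : 1 < α)
      (h : ∀ i, IsE α (φ i)) : IsE α (iSup φ)

/-- The class `𝔄_α`: for `α = 1` the `Π_1` formulas, for `α > 1` the closure of the `𝔈̄_β`, `β < α`,
under `∀` and countable conjunction. -/
inductive IsA : Ordinal.{0} → {n : ℕ} → InfFormula L n → Prop
  | pi_one {n : ℕ} {φ : InfFormula L n} (h : IsPi 1 φ) : IsA 1 φ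
  | of_lt {α β : Ordinal.{0}} {n : ℕ} {φ : InfFormula L n} (hβ : β < α) (h : IsEBar β φ) :
      IsA α φ
  | all {α : Ordinal.{0}} {n : ℕ} {φ : InfFormula L (n + 1)} (hα : 1 < α) (h : IsA α φ) :
      IsA α (all φ)
  | iInf {α : Ordinal.{0}} {n : ℕ} {φ : ℕ → InfFormula L n} (hα : 1 < α)
      (h : ∀ i, IsA α (φ i)) : IsA α (iInf φ)

/-- The class `𝔈̄_α`: the closure of `𝔈_α` under countable disjunction and conjunction. -/
inductive IsEBar : Ordinal.{0} → {n : ℕ} → InfFormula L n → Prop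
  | of_isE {α : Ordinal.{0}} {n : ℕ} {φ : InfFormula L n} (h : IsE α φ) : IsEBar α φ
  | iSup {α : Ordinal.{0}} {n : ℕ} {φ : ℕ → InfFormula L n}
      (h : ∀ i, IsEBar α (φ i)) : IsEBar α (iSup φ)
  | iInf {α : Ordinal.{0}} {n : ℕ} {φ : ℕ → InfFormula L n}
      (h : ∀ i, IsEBar α (φ i)) : IsEBar α (iInf φ)

/-- The class `𝔄̄_α`: the closure of `𝔄_α` under countable disjunction and conjunction. -/
inductive IsABar : Ordinal.{0} → {n : ℕ} → InfFormula L n → Prop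
  | of_isA {α : Ordinal.{0}} {n : ℕ} {φ : InfFormula L n} (h : IsA α φ) : IsABar α φ
  | iSup {α : Ordinal.{0}} {n : ℕ} {φ : ℕ → InfFormula L n}
      (h : ∀ i, IsABar α (φ i)) : IsABar α (iSup φ)
  | iInf {α : Ordinal.{0}} {n : ℕ} {φ : ℕ → InfFormula L n}
      (h : ∀ i, IsABar α (φ i)) : IsABar α (iInf φ)

end

/-- The `∀𝔈_α` formulas: those of the form `⋀ᵢ ∀ȳᵢ ψᵢ` with every `ψᵢ` in `𝔈_α`. -/
def IsForallE (α : Ordinal.{0}) {n : ℕ} (φ : InfFormula L n) : Prop :=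
  ∃ (k : ℕ → ℕ) (ψ : (i : ℕ) → InfFormula L (n + k i)),
    (∀ i, IsE α (ψ i)) ∧ φ = iInf fun i => alls (k i) (ψ i)

/-- `φ` is a Scott sentence of `M`: among the countable structures, it holds exactly in the isomorphic
copies of `M`. -/
def IsScottSentence (φ : InfFormula L 0) (M : Type w) [L.Structure M] : Prop :=
  ∀ (N : Type w) [L.Structure N] [Countable N],
    φ.Realize (Fin.elim0 : Fin 0 → N) ↔ Nonempty (N ≃[L] M)

/-- The `𝔄_α`-type of a tuple: all `𝔄_α` formulas that it satisfies. -/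
def typeA (α : Ordinal.{0}) {M : Type w} [L.Structure M] {n : ℕ} (a : Fin n → M) :
    Set (InfFormula L n) :=
  {ψ | IsA α ψ ∧ ψ.Realize a}

/-- The formula `φ` supports the set of formulas `p` in `M`: it is satisfied by some tuple of `M`, and
every tuple of `M` that satisfies `φ` satisfies all of `p`. -/
def Supports (M : Type w) [L.Structure M] {n : ℕ} (φ : InfFormula L n)
    (p : Set (InfFormula L n)) : Prop :=
  (∃ b : Fin n → M, φ.Realize b) ∧ ∀ b : Fin n → M, φ.Realize b → ∀ ψ ∈ p, ψ.Realize b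

/-- The set of tuples of `M` defined by a formula. -/
def definedSet (M : Type w) [L.Structure M] {n : ℕ} (φ : InfFormula L n) : Set (Fin n → M) :=
  {b | φ.Realize b}

end InfFormula

/-- The orbit of a tuple of `M` under the automorphism group of `M`. -/
def autOrbit (L : FirstOrder.Language.{u, v}) {M : Type w} [L.Structure M] {n : ℕ} (a : Fin n → M) :
    Set (Fin n → M) :=
  {b | ∃ f : M ≃[L] M, b = f ∘ a}

/-- The Scott rank of `M`: the least `α` such that `M` has a `Π_{α+1}` Scott sentence (`⊤` if there
were no such `α`). -/
noncomputable def scottRank (L : FirstOrder.Language.{u, v}) (M : Type w) [L.Structure M] :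
    WithTop Ordinal.{0} :=
  ⨅ (α : Ordinal.{0}) (_ : ∃ φ : InfFormula L 0, φ.IsPi (α + 1) ∧ φ.IsScottSentence M),
    (α : WithTop Ordinal.{0})

/-!
Write `1`–`5` for the five statements.  The circle `1 → 2 → 3 → 4 → 1` and `4 ↔ 5` are proved; all
classes of formulas are used up to equivalence (`UpTo`), so that they have the expected closure
properties, duals under negation included.

* `1 → 2` is an omitting types theorem (`IsScottSentence.exists_supports`).  If no `𝔈_α` formula
  supports the `𝔄_α`-type of `a` in `M`, take a sufficiently generic filter on the valuations
  `ℕ → M` of countably many constants, the conditions being nonempty sets of valuations given by an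
  `𝔈_α` formula about finitely many constants.  The constants form a structure, `Henkin`, in which
  every `𝔈_α` formula that holds for almost all valuations is true (`isForcible_of_le`).  Hence the
  Scott sentence is true in it.  The set of values which a condition allows for a tuple of constants
  is `𝔈_α` definable, so it contains a tuple of `M` not realizing the type, and a condition can be
  strengthened to force this.  So no tuple of the structure realizes the type, although the
  structure is isomorphic to `M`.
* `2 → 3`: the pairs `a, b` such that `b` satisfies the formula supporting the type of `a` form a
  back-and-forth system, so that `b` is in the orbit of `a` (`exists_definedSet_eq_autOrbit`).
* `3 → 4`: although an `𝔈_α` formula need not be equivalent to a `Σ_α` formula, it is so within the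
  countable structure `M` (`IsE.exists_sigma`).  Given `Σ_α` formulas defining the orbits, a
  `Π_{α+1}` sentence expresses that they give a back-and-forth system with `M`
  (`exists_isPi_isScottSentence`).
* `4 → 1` holds as `Σ_α` formulas are `𝔈_α` up to equivalence (`IsPi.upTo_forallE`), and `4 ↔ 5` as
  the `Π_{α+1}` formulas increase with `α` and the infimum that defines the Scott rank is attained.
-/

namespace InfFormula

variable {L : FirstOrder.Language.{u, v}}

/-! ### Renaming of variables, negation and equivalence -/

/-- The formula obtained by renaming the free variables along `f`. -/
def rename : {n : ℕ} → InfFormula L n → {m : ℕ} → (Fin n → Fin m) → InfFormula L m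
  | _, falsum, _, _ => falsum
  | _, equal i j, _, f => equal (f i) (f j)
  | _, rel R t, _, f => rel R fun i => f (t i)
  | _, imp φ ψ, _, f => imp (φ.rename f) (ψ.rename f)
  | _, iInf φ, _, f => iInf fun i => (φ i).rename f
  | _, iSup φ, _, f => iSup fun i => (φ i).rename f
  | n, all φ, m, f =>
    all (φ.rename (Fin.snoc (fun i => (f i).castSucc) (Fin.last m) : Fin (n + 1) → Fin (m + 1)))
  | n, ex φ, m, f =>
    ex (φ.rename (Fin.snoc (fun i => (f i).castSucc) (Fin.last m) : Fin (n + 1) → Fin (m + 1)))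

/-- Negation. -/
def neg {n : ℕ} (φ : InfFormula L n) : InfFormula L n := imp φ falsum

/-- Binary conjunction, as a countable conjunction. -/
def and {n : ℕ} (φ ψ : InfFormula L n) : InfFormula L n := iInf fun i => if i = 0 then φ else ψ

open Classical in
/-- The conjunction of a family indexed by a countable type; it is a true formula if the index type
is empty. -/
noncomputable def conj {ι : Type*} [Countable ι] {n : ℕ} (φ : ι → InfFormula L n) :
    InfFormula L n :=
  if _h : Nonempty ι then iInf fun i => φ ((exists_surjective_nat ι).choose i) else neg falsum

open Classical in
/-- The disjunction of a family indexed by a countable type; it is a false formula if the index type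
is empty. -/
noncomputable def disj {ι : Type*} [Countable ι] {n : ℕ} (φ : ι → InfFormula L n) :
    InfFormula L n :=
  if _h : Nonempty ι then iSup fun i => φ ((exists_surjective_nat ι).choose i) else falsum

section Realize

variable {N : Type w} [L.Structure N] {n m : ℕ}

theorem snoc_comp_snoc (f : Fin n → Fin m) (a : Fin m → N) (x : N) :
    (fun i => (Fin.snoc a x : Fin (m + 1) → N)
      ((Fin.snoc (fun i => (f i).castSucc) (Fin.last m) : Fin (n + 1) → Fin (m + 1)) i)) =
      (Fin.snoc (fun i => a (f i)) x : Fin (n + 1) → N) := by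
  funext i
  induction i using Fin.lastCases <;> simp

theorem realize_rename (φ : InfFormula L n) (f : Fin n → Fin m) (a : Fin m → N) :
    (φ.rename f).Realize a ↔ φ.Realize fun i => a (f i) := by
  induction φ generalizing m with
  | falsum => simp [rename, Realize]
  | equal => simp [rename, Realize]
  | rel => simp [rename, Realize]
  | imp φ ψ h₁ h₂ => simp [rename, Realize, h₁, h₂]
  | iInf φ h => simp [rename, Realize, h]
  | iSup φ h => simp [rename, Realize, h]
  | all φ h => simp only [rename, Realize, h, snoc_comp_snoc]
  | ex φ h => simp only [rename, Realize, h, snoc_comp_snoc]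

@[simp]
theorem realize_neg (φ : InfFormula L n) (a : Fin n → N) : φ.neg.Realize a ↔ ¬ φ.Realize a :=
  Iff.rfl

@[simp]
theorem realize_and (φ ψ : InfFormula L n) (a : Fin n → N) :
    (φ.and ψ).Realize a ↔ φ.Realize a ∧ ψ.Realize a := by
  simp only [and, Realize]
  exact ⟨fun h => ⟨by simpa using h 0, by simpa using h 1⟩,
    fun h i => by split_ifs; exacts [h.1, h.2]⟩

@[simp]
theorem realize_conj {ι : Type*} [Countable ι] (φ : ι → InfFormula L n) (a : Fin n → N) :
    (conj φ).Realize a ↔ ∀ i, (φ i).Realize a := by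
  unfold conj
  split_ifs with h
  · simp only [Realize]
    exact ((exists_surjective_nat ι).choose_spec.forall (p := fun i => (φ i).Realize a)).symm
  · simp only [realize_neg, Realize, not_false_eq_true, true_iff]
    exact fun i => (h ⟨i⟩).elim

@[simp]
theorem realize_disj {ι : Type*} [Countable ι] (φ : ι → InfFormula L n) (a : Fin n → N) :
    (disj φ).Realize a ↔ ∃ i, (φ i).Realize a := by
  unfold disj
  split_ifs with h
  · simp only [Realize]
    exact ((exists_surjective_nat ι).choose_spec.exists (p := fun i => (φ i).Realize a)).symm
  · simp only [Realize, false_iff, not_exists]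
    exact fun i => (h ⟨i⟩).elim

theorem realize_exs (k : ℕ) (φ : InfFormula L (n + k)) (a : Fin n → N) :
    (exs k φ).Realize a ↔ ∃ y : Fin k → N, φ.Realize (Fin.append a y) := by
  induction k with
  | zero =>
    have h : ∀ y : Fin 0 → N, Fin.append a y = a := fun y => by
      rw [Fin.append_right_nil _ _ rfl]; rfl
    simp [exs, h]
  | succ k ih =>
    simp only [exs, ih, Realize]
    constructor
    · rintro ⟨y, x, h⟩
      refine ⟨Fin.snoc y x, ?_⟩
      rwa [Fin.append_snoc]
    · rintro ⟨y, h⟩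
      refine ⟨Fin.init y, y (Fin.last k), ?_⟩
      rwa [← Fin.append_snoc, Fin.snoc_init_self]

theorem realize_alls (k : ℕ) (φ : InfFormula L (n + k)) (a : Fin n → N) :
    (alls k φ).Realize a ↔ ∀ y : Fin k → N, φ.Realize (Fin.append a y) := by
  induction k with
  | zero =>
    have h : ∀ y : Fin 0 → N, Fin.append a y = a := fun y => by
      rw [Fin.append_right_nil _ _ rfl]; rfl
    simp [alls, h]
  | succ k ih =>
    simp only [alls, ih, Realize]
    constructor
    · intro h y
      rw [← Fin.snoc_init_self y, Fin.append_snoc]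
      exact h _ _
    · intro h y x
      have := h (Fin.snoc y x)
      rwa [Fin.append_snoc] at this

theorem realize_equiv {M : Type*} [L.Structure M] (φ : InfFormula L n) (f : M ≃[L] N)
    (a : Fin n → M) : φ.Realize (fun i => f (a i)) ↔ φ.Realize a := by
  have snoc_map : ∀ {n : ℕ} (a : Fin n → M) (x : M),
      (Fin.snoc (fun i => f (a i)) (f x) : Fin (n + 1) → N) =
        fun i => f ((Fin.snoc a x : Fin (n + 1) → M) i) := by
    intro n a x
    funext i
    induction i using Fin.lastCases <;> simp
  induction φ with
  | falsum => simp [Realize]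
  | equal => simp [Realize]
  | rel R t => exact f.map_rel R fun i => a (t i)
  | imp φ ψ h₁ h₂ => simp [Realize, h₁, h₂]
  | iInf φ h => simp [Realize, h]
  | iSup φ h => simp [Realize, h]
  | all φ h =>
    simp only [Realize]
    rw [f.surjective.forall]
    simp only [snoc_map, h]
  | ex φ h =>
    simp only [Realize]
    rw [f.surjective.exists]
    simp only [snoc_map, h]

end Realize

/-- `UpTo C φ` says that `φ` is equivalent, in all structures of the universe `w`, to a formula of
the class `C`. -/
def UpTo {n : ℕ} (C : InfFormula L n → Prop) (φ : InfFormula L n) : Prop :=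
  ∃ ψ, C ψ ∧ ∀ (N : Type w) [L.Structure N] (b : Fin n → N), φ.Realize b ↔ ψ.Realize b

theorem UpTo.of {n : ℕ} {C : InfFormula L n → Prop} {φ : InfFormula L n} (h : C φ) :
    UpTo.{u, v, w} C φ :=
  ⟨φ, h, fun _ _ _ => Iff.rfl⟩

theorem UpTo.congr {n : ℕ} {C : InfFormula L n → Prop} {φ ψ : InfFormula L n}
    (h : UpTo.{u, v, w} C ψ)
    (e : ∀ (N : Type w) [L.Structure N] (b : Fin n → N), φ.Realize b ↔ ψ.Realize b) :
    UpTo.{u, v, w} C φ := by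
  obtain ⟨χ, hχ, e'⟩ := h
  exact ⟨χ, hχ, fun N _ b => (e N b).trans (e' N b)⟩

theorem IsQF.rename {n m : ℕ} {φ : InfFormula L n} (h : IsQF φ) (f : Fin n → Fin m) :
    IsQF (φ.rename f) := by
  induction h generalizing m with
  | falsum => exact .falsum
  | equal => exact .equal _ _
  | rel => exact .rel _ _
  | imp _ _ h₁ h₂ => exact .imp (h₁ f) (h₂ f)

theorem IsQF.neg {n : ℕ} {φ : InfFormula L n} (h : IsQF φ) : IsQF φ.neg := .imp h .falsum

/-! ### The hierarchy of `Σ_α` and `Π_α` formulas -/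

theorem UpTo.iSup_exs {α : Ordinal.{0}} {n : ℕ} {k : ℕ → ℕ} {ψ : (i : ℕ) → InfFormula L (n + k i)}
    (h : ∀ i, ∃ β < α, UpTo.{u, v, w} (IsPi β) (ψ i)) :
    UpTo.{u, v, w} (IsSigma α) (iSup fun i => exs (k i) (ψ i)) := by
  choose β hβ χ hχ e using h
  refine ⟨_, .iSup_exs k χ β hβ hχ, fun N _ b => ?_⟩
  simp only [Realize, realize_exs, e]

theorem UpTo.iInf_alls {α : Ordinal.{0}} {n : ℕ} {k : ℕ → ℕ} {ψ : (i : ℕ) → InfFormula L (n + k i)}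
    (h : ∀ i, ∃ β < α, UpTo.{u, v, w} (IsSigma β) (ψ i)) :
    UpTo.{u, v, w} (IsPi α) (iInf fun i => alls (k i) (ψ i)) := by
  choose β hβ χ hχ e using h
  refine ⟨_, .iInf_alls k χ β hβ hχ, fun N _ b => ?_⟩
  simp only [Realize, realize_alls, e]

theorem isQF_of_isSigma_zero {n : ℕ} {φ : InfFormula L n} (h : IsSigma 0 φ) : IsQF φ := by
  generalize hα : (0 : Ordinal.{0}) = α at h
  cases h with
  | qf h => exact h
  | iSup_exs k ψ β hβ h => subst hα; exact (not_lt_zero (hβ 0)).elim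

theorem isQF_of_isPi_zero {n : ℕ} {φ : InfFormula L n} (h : IsPi 0 φ) : IsQF φ := by
  generalize hα : (0 : Ordinal.{0}) = α at h
  cases h with
  | qf h => exact h
  | iInf_alls k ψ β hβ h => subst hα; exact (not_lt_zero (hβ 0)).elim

theorem isSigma_isPi_neg (α : Ordinal.{0}) :
    (∀ {n : ℕ} {φ : InfFormula L n}, IsSigma α φ → UpTo.{u, v, w} (IsPi α) φ.neg) ∧
      ∀ {n : ℕ} {φ : InfFormula L n}, IsPi α φ → UpTo.{u, v, w} (IsSigma α) φ.neg := by
  induction α using WellFoundedLT.induction with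
  | ind α ih =>
    refine ⟨fun {n φ} h => ?_, fun {n φ} h => ?_⟩
    · cases h with
      | qf h => exact .of (.qf h.neg)
      | iSup_exs k ψ β hβ h =>
        refine UpTo.congr (UpTo.iInf_alls (k := k) (ψ := fun i => (ψ i).neg)
          fun i => ⟨β i, hβ i, (ih _ (hβ i)).2 (h i)⟩) fun N _ b => ?_
        simp [Realize, realize_exs, realize_alls]
    · cases h with
      | qf h => exact .of (.qf h.neg)
      | iInf_alls k ψ β hβ h =>
        refine UpTo.congr (UpTo.iSup_exs (k := k) (ψ := fun i => (ψ i).neg)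
          fun i => ⟨β i, hβ i, (ih _ (hβ i)).1 (h i)⟩) fun N _ b => ?_
        simp [Realize, realize_exs, realize_alls]

theorem isSigma_isPi_rename (α : Ordinal.{0}) :
    (∀ {n : ℕ} {φ : InfFormula L n}, IsSigma α φ → ∀ {m : ℕ} (f : Fin n → Fin m),
      UpTo.{u, v, w} (IsSigma α) (φ.rename f)) ∧
      ∀ {n : ℕ} {φ : InfFormula L n}, IsPi α φ → ∀ {m : ℕ} (f : Fin n → Fin m),
        UpTo.{u, v, w} (IsPi α) (φ.rename f) := by
  have append_comp : ∀ {N : Type w} {n m k : ℕ} (f : Fin n → Fin m) (b : Fin m → N) (y : Fin k → N),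
      (fun i => Fin.append b y (Fin.append (fun i => Fin.castAdd k (f i)) (Fin.natAdd m) i)) =
        Fin.append (fun i => b (f i)) y := by
    intro N n m k f b y
    funext i
    induction i using Fin.addCases <;> simp
  induction α using WellFoundedLT.induction with
  | ind α ih =>
    refine ⟨fun {n φ} h m f => ?_, fun {n φ} h m f => ?_⟩
    · cases h with
      | qf h => exact .of (.qf (h.rename f))
      | iSup_exs k ψ β hβ h =>
        refine UpTo.congr (UpTo.iSup_exs (k := k) (ψ := fun i => (ψ i).rename
          (Fin.append (fun j => Fin.castAdd (k i) (f j)) (Fin.natAdd m)))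
          fun i => ⟨β i, hβ i, (ih _ (hβ i)).2 (h i) _⟩) fun N _ b => ?_
        simp only [Realize, realize_rename, realize_exs, append_comp]
    · cases h with
      | qf h => exact .of (.qf (h.rename f))
      | iInf_alls k ψ β hβ h =>
        refine UpTo.congr (UpTo.iInf_alls (k := k) (ψ := fun i => (ψ i).rename
          (Fin.append (fun j => Fin.castAdd (k i) (f j)) (Fin.natAdd m)))
          fun i => ⟨β i, hβ i, (ih _ (hβ i)).1 (h i) _⟩) fun N _ b => ?_
        simp only [Realize, realize_rename, realize_alls, append_comp]

section SigmaPi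

variable {α β : Ordinal.{0}} {n m : ℕ}

theorem UpTo.neg_sigma {φ : InfFormula L n} (h : UpTo.{u, v, w} (IsSigma α) φ) :
    UpTo.{u, v, w} (IsPi α) φ.neg := by
  obtain ⟨ψ, hψ, e⟩ := h
  exact ((isSigma_isPi_neg α).1 hψ).congr fun N _ b => by simp [e]

theorem UpTo.neg_pi {φ : InfFormula L n} (h : UpTo.{u, v, w} (IsPi α) φ) :
    UpTo.{u, v, w} (IsSigma α) φ.neg := by
  obtain ⟨ψ, hψ, e⟩ := h
  exact ((isSigma_isPi_neg α).2 hψ).congr fun N _ b => by simp [e]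

theorem UpTo.rename_sigma {φ : InfFormula L n} (h : UpTo.{u, v, w} (IsSigma α) φ)
    (f : Fin n → Fin m) : UpTo.{u, v, w} (IsSigma α) (φ.rename f) := by
  obtain ⟨ψ, hψ, e⟩ := h
  exact ((isSigma_isPi_rename α).1 hψ f).congr fun N _ b => by simp [realize_rename, e]

theorem UpTo.rename_pi {m : ℕ} {φ : InfFormula L n} (h : UpTo.{u, v, w} (IsPi α) φ)
    (f : Fin n → Fin m) : UpTo.{u, v, w} (IsPi α) (φ.rename f) := by
  obtain ⟨ψ, hψ, e⟩ := h
  exact ((isSigma_isPi_rename α).2 hψ f).congr fun N _ b => by simp [realize_rename, e]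

theorem UpTo.sigma_of_pi_lt {φ : InfFormula L n} (h : UpTo.{u, v, w} (IsPi β) φ) (hβ : β < α) :
    UpTo.{u, v, w} (IsSigma α) φ :=
  (UpTo.iSup_exs (k := fun _ => 0) (ψ := fun _ => φ) fun _ => ⟨β, hβ, h⟩).congr
    fun N _ b => by simp [Realize, exs]

theorem UpTo.pi_of_sigma_lt {φ : InfFormula L n} (h : UpTo.{u, v, w} (IsSigma β) φ) (hβ : β < α) :
    UpTo.{u, v, w} (IsPi α) φ :=
  (UpTo.iInf_alls (k := fun _ => 0) (ψ := fun _ => φ) fun _ => ⟨β, hβ, h⟩).congr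
    fun N _ b => by simp [Realize, alls]

theorem IsQF.upTo_pi {φ : InfFormula L n} (h : IsQF φ) (α : Ordinal.{0}) :
    UpTo.{u, v, w} (IsPi α) φ := by
  rcases eq_zero_or_pos α with rfl | hα
  · exact .of (.qf h)
  · exact UpTo.pi_of_sigma_lt (.of (.qf h)) hα

theorem IsQF.upTo_sigma {φ : InfFormula L n} (h : IsQF φ) (α : Ordinal.{0}) :
    UpTo.{u, v, w} (IsSigma α) φ := by
  rcases eq_zero_or_pos α with rfl | hα
  · exact .of (.qf h)
  · exact UpTo.sigma_of_pi_lt (.of (.qf h)) hα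

theorem UpTo.mono_sigma {φ : InfFormula L n} (h : UpTo.{u, v, w} (IsSigma β) φ) (hβ : β ≤ α) :
    UpTo.{u, v, w} (IsSigma α) φ := by
  obtain ⟨ψ, hψ, e⟩ := h
  refine UpTo.congr ?_ e
  cases hψ with
  | qf h => exact h.upTo_sigma α
  | iSup_exs k ψ γ hγ h => exact .of (.iSup_exs k ψ γ (fun i => (hγ i).trans_le hβ) h)

theorem UpTo.sigma_iSup {φ : ℕ → InfFormula L n} (hα : 1 ≤ α)
    (h : ∀ i, UpTo.{u, v, w} (IsSigma α) (φ i)) : UpTo.{u, v, w} (IsSigma α) (iSup φ) := by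
  have hφ : ∀ i, ∃ (k : ℕ → ℕ) (ψ : (j : ℕ) → InfFormula L (n + k j)),
      (∀ j, ∃ γ < α, IsPi γ (ψ j)) ∧ ∀ (N : Type w) [L.Structure N] (b : Fin n → N),
        (φ i).Realize b ↔ ∃ j, (exs (k j) (ψ j)).Realize b := by
    intro i
    obtain ⟨χ, hχ, e⟩ := h i
    cases hχ with
    | qf h => simp at hα
    | iSup_exs k ψ γ hγ h => exact ⟨k, ψ, fun j => ⟨γ j, hγ j, h j⟩, e⟩
  choose k ψ hψ e using hφ
  refine UpTo.congr (UpTo.iSup_exs (k := fun i => k i.unpair.1 i.unpair.2)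
    (ψ := fun i => ψ i.unpair.1 i.unpair.2) fun i => ?_) fun N _ b => ?_
  · obtain ⟨γ, hγ, h⟩ := hψ i.unpair.1 i.unpair.2
    exact ⟨γ, hγ, .of h⟩
  · simp only [Realize, e]
    constructor
    · rintro ⟨i, j, h⟩
      exact ⟨Nat.pair i j, by rwa [Nat.unpair_pair]⟩
    · rintro ⟨i, h⟩
      exact ⟨_, _, h⟩

theorem UpTo.sigma_ex {φ : InfFormula L (n + 1)} (hα : 1 ≤ α)
    (h : UpTo.{u, v, w} (IsSigma α) φ) : UpTo.{u, v, w} (IsSigma α) (ex φ) := by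
  obtain ⟨χ, hχ, e⟩ := h
  cases hχ with
  | qf h => simp at hα
  | iSup_exs k ψ γ hγ h =>
    refine UpTo.congr (UpTo.iSup_exs (k := fun i => k i + 1)
      (ψ := fun i => (ψ i).rename (Fin.cast (Nat.succ_add_eq_add_succ n (k i))))
      fun i => ⟨γ i, hγ i, (isSigma_isPi_rename _).2 (h i) _⟩) fun N _ b => ?_
    have key : ∀ (k : ℕ) (x : N) (y : Fin k → N),
        Fin.append (Fin.snoc b x : Fin (n + 1) → N) y =
          fun i => Fin.append b (Fin.cons x y : Fin (k + 1) → N)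
            (Fin.cast (Nat.succ_add_eq_add_succ n k) i) :=
      fun k x y => Fin.append_left_snoc b x y
    simp only [Realize, e, realize_exs, realize_rename, key]
    constructor
    · rintro ⟨x, i, y, h⟩
      exact ⟨i, _, h⟩
    · rintro ⟨i, y, h⟩
      refine ⟨y 0, i, Fin.tail y, ?_⟩
      rwa [Fin.cons_self_tail]

theorem UpTo.pi_iInf {φ : ℕ → InfFormula L n} (hα : 1 ≤ α)
    (h : ∀ i, UpTo.{u, v, w} (IsPi α) (φ i)) : UpTo.{u, v, w} (IsPi α) (iInf φ) :=
  (UpTo.sigma_iSup hα fun i => (h i).neg_pi).neg_sigma.congr fun N _ b => by simp [Realize]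

theorem UpTo.pi_all {φ : InfFormula L (n + 1)} (hα : 1 ≤ α)
    (h : UpTo.{u, v, w} (IsPi α) φ) : UpTo.{u, v, w} (IsPi α) (all φ) :=
  (UpTo.sigma_ex hα h.neg_pi).neg_sigma.congr fun N _ b => by simp [Realize]

theorem UpTo.sigma_disj {ι : Type*} [Countable ι] {φ : ι → InfFormula L n} (hα : 1 ≤ α)
    (h : ∀ i, UpTo.{u, v, w} (IsSigma α) (φ i)) : UpTo.{u, v, w} (IsSigma α) (disj φ) := by
  unfold disj
  split_ifs
  · exact UpTo.sigma_iSup hα fun _ => h _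
  · exact IsQF.falsum.upTo_sigma α

theorem UpTo.pi_conj {ι : Type*} [Countable ι] {φ : ι → InfFormula L n} (hα : 1 ≤ α)
    (h : ∀ i, UpTo.{u, v, w} (IsPi α) (φ i)) : UpTo.{u, v, w} (IsPi α) (conj φ) := by
  unfold conj
  split_ifs
  · exact UpTo.pi_iInf hα fun _ => h _
  · exact IsQF.falsum.neg.upTo_pi α

theorem IsPi.mono_succ {φ : InfFormula L n} (h : IsPi (β + 1) φ) (hβ : β ≤ α) :
    IsPi (α + 1) φ := by
  generalize hγ : β + 1 = γ at h
  cases h with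
  | qf h => simp at hγ
  | iInf_alls k ψ δ hδ h =>
    subst hγ
    exact .iInf_alls k ψ δ (fun i => (hδ i).trans_le (add_le_add_left hβ 1)) h

end SigmaPi

/-! ### The classes `𝔈_α` and `𝔄_α` up to equivalence -/

section Induction

variable {α : Ordinal.{0}} {n : ℕ}

theorem exs_induction {motive : ∀ {n : ℕ}, InfFormula L n → Prop}
    (ex : ∀ {n : ℕ} {φ : InfFormula L (n + 1)}, motive φ → motive φ.ex) {n : ℕ} (k : ℕ)
    {φ : InfFormula L (n + k)} (h : motive φ) : motive (exs k φ) := by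
  induction k with
  | zero => exact h
  | succ k ih => exact ih (ex h)

theorem alls_induction {motive : ∀ {n : ℕ}, InfFormula L n → Prop}
    (all : ∀ {n : ℕ} {φ : InfFormula L (n + 1)}, motive φ → motive φ.all) {n : ℕ} (k : ℕ)
    {φ : InfFormula L (n + k)} (h : motive φ) : motive (alls k φ) := by
  induction k with
  | zero => exact h
  | succ k ih => exact ih (all h)

/-- The `𝔈_α` formulas, for `α = 1` as well, are generated by `∃` and countable disjunctions from
simpler formulas: quantifier-free ones if `α = 1`, and `𝔄̄_β` ones with `β < α` if `α > 1`. -/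
theorem IsE.induction {motive : ∀ {n : ℕ}, InfFormula L n → Prop}
    (qf : ∀ {n : ℕ} {φ : InfFormula L n}, α = 1 → IsQF φ → motive φ)
    (lt : ∀ {β : Ordinal.{0}} {n : ℕ} {φ : InfFormula L n}, β < α → IsABar β φ → motive φ)
    (ex : ∀ {n : ℕ} {φ : InfFormula L (n + 1)}, motive φ → motive φ.ex)
    (iSup : ∀ {n : ℕ} {φ : ℕ → InfFormula L n}, (∀ i, motive (φ i)) → motive (InfFormula.iSup φ))
    {φ : InfFormula L n} (h₀ : IsE α φ) : motive φ := by
  refine IsE.rec (motive_1 := fun β _ φ _ => β = α → motive φ) (motive_2 := fun _ _ _ _ => True)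
    (motive_3 := fun _ _ _ _ => True) (motive_4 := fun _ _ _ _ => True)
    ?_ ?_ ?_ ?_ (by simp) (by simp) (by simp) (by simp) (by simp) (by simp) (by simp) (by simp)
    (by simp) (by simp) h₀ rfl
  · rintro n φ h rfl
    generalize hα : (1 : Ordinal.{0}) = α at h
    cases h with
    | qf h => simp at hα
    | iSup_exs k ψ β hβ h =>
      subst hα
      refine iSup fun i => exs_induction ex _ (qf rfl (isQF_of_isPi_zero ?_))
      have := hβ i
      rw [Order.lt_one_iff] at this
      exact this ▸ h i
  · rintro α' β n φ hβ h - rfl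
    exact lt hβ h
  · rintro α' n φ - - h rfl
    exact ex (h rfl)
  · rintro α' n φ - - h rfl
    exact iSup fun i => h i rfl

/-- The `𝔄_α` formulas, for `α = 1` as well, are generated by `∀` and countable conjunctions from
simpler formulas: quantifier-free ones if `α = 1`, and `𝔈̄_β` ones with `β < α` if `α > 1`. -/
theorem IsA.induction {motive : ∀ {n : ℕ}, InfFormula L n → Prop}
    (qf : ∀ {n : ℕ} {φ : InfFormula L n}, α = 1 → IsQF φ → motive φ)
    (lt : ∀ {β : Ordinal.{0}} {n : ℕ} {φ : InfFormula L n}, β < α → IsEBar β φ → motive φ)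
    (all : ∀ {n : ℕ} {φ : InfFormula L (n + 1)}, motive φ → motive φ.all)
    (iInf : ∀ {n : ℕ} {φ : ℕ → InfFormula L n}, (∀ i, motive (φ i)) → motive (InfFormula.iInf φ))
    {φ : InfFormula L n} (h₀ : IsA α φ) : motive φ := by
  refine IsA.rec (motive_2 := fun β _ φ _ => β = α → motive φ) (motive_1 := fun _ _ _ _ => True)
    (motive_3 := fun _ _ _ _ => True) (motive_4 := fun _ _ _ _ => True)
    (by simp) (by simp) (by simp) (by simp) ?_ ?_ ?_ ?_ (by simp) (by simp) (by simp) (by simp)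
    (by simp) (by simp) h₀ rfl
  · rintro n φ h rfl
    generalize hα : (1 : Ordinal.{0}) = α at h
    cases h with
    | qf h => simp at hα
    | iInf_alls k ψ β hβ h =>
      subst hα
      refine iInf fun i => alls_induction all _ (qf rfl (isQF_of_isSigma_zero ?_))
      have := hβ i
      rw [Order.lt_one_iff] at this
      exact this ▸ h i
  · rintro α' β n φ hβ h - rfl
    exact lt hβ h
  · rintro α' n φ - - h rfl
    exact all (h rfl)
  · rintro α' n φ - - h rfl
    exact iInf fun i => h i rfl

theorem IsEBar.induction {motive : ∀ {n : ℕ}, InfFormula L n → Prop}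
    (of_isE : ∀ {n : ℕ} {φ : InfFormula L n}, IsE α φ → motive φ)
    (iSup : ∀ {n : ℕ} {φ : ℕ → InfFormula L n}, (∀ i, motive (φ i)) → motive (InfFormula.iSup φ))
    (iInf : ∀ {n : ℕ} {φ : ℕ → InfFormula L n}, (∀ i, motive (φ i)) → motive (InfFormula.iInf φ))
    {φ : InfFormula L n} (h₀ : IsEBar α φ) : motive φ := by
  refine IsEBar.rec (motive_3 := fun β _ φ _ => β = α → motive φ)
    (motive_1 := fun _ _ _ _ => True) (motive_2 := fun _ _ _ _ => True)
    (motive_4 := fun _ _ _ _ => True)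
    (by simp) (by simp) (by simp) (by simp) (by simp) (by simp) (by simp) (by simp) ?_ ?_ ?_
    (by simp) (by simp) (by simp) h₀ rfl
  · rintro α' n φ h - rfl
    exact of_isE h
  · rintro α' n φ - h rfl
    exact iSup fun i => h i rfl
  · rintro α' n φ - h rfl
    exact iInf fun i => h i rfl

theorem IsABar.induction {motive : ∀ {n : ℕ}, InfFormula L n → Prop}
    (of_isA : ∀ {n : ℕ} {φ : InfFormula L n}, IsA α φ → motive φ)
    (iSup : ∀ {n : ℕ} {φ : ℕ → InfFormula L n}, (∀ i, motive (φ i)) → motive (InfFormula.iSup φ))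
    (iInf : ∀ {n : ℕ} {φ : ℕ → InfFormula L n}, (∀ i, motive (φ i)) → motive (InfFormula.iInf φ))
    {φ : InfFormula L n} (h₀ : IsABar α φ) : motive φ := by
  refine IsABar.rec (motive_4 := fun β _ φ _ => β = α → motive φ)
    (motive_1 := fun _ _ _ _ => True) (motive_2 := fun _ _ _ _ => True)
    (motive_3 := fun _ _ _ _ => True)
    (by simp) (by simp) (by simp) (by simp) (by simp) (by simp) (by simp) (by simp) (by simp)
    (by simp) (by simp) ?_ ?_ ?_ h₀ rfl
  · rintro α' n φ h - rfl
    exact of_isA h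
  · rintro α' n φ - h rfl
    exact iSup fun i => h i rfl
  · rintro α' n φ - h rfl
    exact iInf fun i => h i rfl

theorem IsE.one_le {φ : InfFormula L n} (h : IsE α φ) : 1 ≤ α := by
  cases h with
  | sigma_one h => exact le_rfl
  | of_lt hβ h => exact Order.one_le_iff_pos.2 ((zero_le).trans_lt hβ)
  | ex hα h => exact hα.le
  | iSup hα h => exact hα.le

theorem IsA.one_le {φ : InfFormula L n} (h : IsA α φ) : 1 ≤ α := by
  cases h with
  | pi_one h => exact le_rfl
  | of_lt hβ h => exact Order.one_le_iff_pos.2 ((zero_le).trans_lt hβ)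
  | all hα h => exact hα.le
  | iInf hα h => exact hα.le

theorem IsEBar.one_le {φ : InfFormula L n} (h : IsEBar α φ) : 1 ≤ α :=
  IsEBar.induction (motive := fun _ => 1 ≤ α) IsE.one_le (fun h => h 0) (fun h => h 0) h

theorem IsABar.one_le {φ : InfFormula L n} (h : IsABar α φ) : 1 ≤ α :=
  IsABar.induction (motive := fun _ => 1 ≤ α) IsA.one_le (fun h => h 0) (fun h => h 0) h

end Induction

section Closure

variable {α β : Ordinal.{0}} {n m : ℕ}

theorem UpTo.e_bar {φ : InfFormula L n} (h : UpTo.{u, v, w} (IsE α) φ) :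
    UpTo.{u, v, w} (IsEBar α) φ := by
  obtain ⟨ψ, hψ, e⟩ := h
  exact ⟨ψ, .of_isE hψ, e⟩

theorem UpTo.a_bar {φ : InfFormula L n} (h : UpTo.{u, v, w} (IsA α) φ) :
    UpTo.{u, v, w} (IsABar α) φ := by
  obtain ⟨ψ, hψ, e⟩ := h
  exact ⟨ψ, .of_isA hψ, e⟩

theorem UpTo.e_of_lt {φ : InfFormula L n} (h : UpTo.{u, v, w} (IsABar β) φ) (hβ : β < α) :
    UpTo.{u, v, w} (IsE α) φ := by
  obtain ⟨ψ, hψ, e⟩ := h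
  exact ⟨ψ, .of_lt hβ hψ, e⟩

theorem UpTo.a_of_lt {φ : InfFormula L n} (h : UpTo.{u, v, w} (IsEBar β) φ) (hβ : β < α) :
    UpTo.{u, v, w} (IsA α) φ := by
  obtain ⟨ψ, hψ, e⟩ := h
  exact ⟨ψ, .of_lt hβ hψ, e⟩

theorem UpTo.e_one {φ : InfFormula L n} (h : UpTo.{u, v, w} (IsSigma 1) φ) :
    UpTo.{u, v, w} (IsE 1) φ := by
  obtain ⟨ψ, hψ, e⟩ := h
  exact ⟨ψ, .sigma_one hψ, e⟩

theorem UpTo.a_one {φ : InfFormula L n} (h : UpTo.{u, v, w} (IsPi 1) φ) :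
    UpTo.{u, v, w} (IsA 1) φ := by
  obtain ⟨ψ, hψ, e⟩ := h
  exact ⟨ψ, .pi_one hψ, e⟩

theorem isSigma_one_of_isE {φ : InfFormula L n} (h : IsE 1 φ) :
    UpTo.{u, v, w} (IsSigma 1) φ :=
  IsE.induction (motive := fun φ => UpTo.{u, v, w} (IsSigma 1) φ) (fun _ h => h.upTo_sigma 1)
    (fun hβ h => (h.one_le.not_gt hβ).elim) (UpTo.sigma_ex le_rfl) (UpTo.sigma_iSup le_rfl) h

theorem isPi_one_of_isA {φ : InfFormula L n} (h : IsA 1 φ) : UpTo.{u, v, w} (IsPi 1) φ :=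
  IsA.induction (motive := fun φ => UpTo.{u, v, w} (IsPi 1) φ) (fun _ h => h.upTo_pi 1)
    (fun hβ h => (h.one_le.not_gt hβ).elim) (UpTo.pi_all le_rfl) (UpTo.pi_iInf le_rfl) h

theorem UpTo.sigma_of_e_one {φ : InfFormula L n} (h : UpTo.{u, v, w} (IsE 1) φ) :
    UpTo.{u, v, w} (IsSigma 1) φ := by
  obtain ⟨ψ, hψ, e⟩ := h
  exact (isSigma_one_of_isE hψ).congr e

theorem UpTo.pi_of_a_one {φ : InfFormula L n} (h : UpTo.{u, v, w} (IsA 1) φ) :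
    UpTo.{u, v, w} (IsPi 1) φ := by
  obtain ⟨ψ, hψ, e⟩ := h
  exact (isPi_one_of_isA hψ).congr e

theorem UpTo.e_ex {φ : InfFormula L (n + 1)} (h : UpTo.{u, v, w} (IsE α) φ) :
    UpTo.{u, v, w} (IsE α) (ex φ) := by
  obtain ⟨ψ, hψ, e⟩ := h
  rcases hψ.one_le.eq_or_lt with rfl | hα
  · exact (UpTo.sigma_ex le_rfl (UpTo.sigma_of_e_one ⟨ψ, hψ, e⟩)).e_one
  · exact ⟨ex ψ, .ex hα hψ, fun N _ b => by simp [Realize, e]⟩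

theorem UpTo.a_all {φ : InfFormula L (n + 1)} (h : UpTo.{u, v, w} (IsA α) φ) :
    UpTo.{u, v, w} (IsA α) (all φ) := by
  obtain ⟨ψ, hψ, e⟩ := h
  rcases hψ.one_le.eq_or_lt with rfl | hα
  · exact (UpTo.pi_all le_rfl (UpTo.pi_of_a_one ⟨ψ, hψ, e⟩)).a_one
  · exact ⟨all ψ, .all hα hψ, fun N _ b => by simp [Realize, e]⟩

theorem UpTo.e_iSup {φ : ℕ → InfFormula L n} (h : ∀ i, UpTo.{u, v, w} (IsE α) (φ i)) :
    UpTo.{u, v, w} (IsE α) (iSup φ) := by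
  obtain ⟨χ, hχ, -⟩ := h 0
  rcases hχ.one_le.eq_or_lt with rfl | hα
  · exact (UpTo.sigma_iSup le_rfl fun i => (h i).sigma_of_e_one).e_one
  · choose ψ hψ e using h
    exact ⟨iSup ψ, .iSup hα hψ, fun N _ b => by simp [Realize, e]⟩

theorem UpTo.a_iInf {φ : ℕ → InfFormula L n} (h : ∀ i, UpTo.{u, v, w} (IsA α) (φ i)) :
    UpTo.{u, v, w} (IsA α) (iInf φ) := by
  obtain ⟨χ, hχ, -⟩ := h 0
  rcases hχ.one_le.eq_or_lt with rfl | hα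
  · exact (UpTo.pi_iInf le_rfl fun i => (h i).pi_of_a_one).a_one
  · choose ψ hψ e using h
    exact ⟨iInf ψ, .iInf hα hψ, fun N _ b => by simp [Realize, e]⟩

theorem UpTo.eBar_iSup {φ : ℕ → InfFormula L n} (h : ∀ i, UpTo.{u, v, w} (IsEBar α) (φ i)) :
    UpTo.{u, v, w} (IsEBar α) (iSup φ) := by
  choose ψ hψ e using h
  exact ⟨iSup ψ, .iSup hψ, fun N _ b => by simp [Realize, e]⟩

theorem UpTo.eBar_iInf {φ : ℕ → InfFormula L n} (h : ∀ i, UpTo.{u, v, w} (IsEBar α) (φ i)) :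
    UpTo.{u, v, w} (IsEBar α) (iInf φ) := by
  choose ψ hψ e using h
  exact ⟨iInf ψ, .iInf hψ, fun N _ b => by simp [Realize, e]⟩

theorem UpTo.aBar_iSup {φ : ℕ → InfFormula L n} (h : ∀ i, UpTo.{u, v, w} (IsABar α) (φ i)) :
    UpTo.{u, v, w} (IsABar α) (iSup φ) := by
  choose ψ hψ e using h
  exact ⟨iSup ψ, .iSup hψ, fun N _ b => by simp [Realize, e]⟩

theorem UpTo.aBar_iInf {φ : ℕ → InfFormula L n} (h : ∀ i, UpTo.{u, v, w} (IsABar α) (φ i)) :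
    UpTo.{u, v, w} (IsABar α) (iInf φ) := by
  choose ψ hψ e using h
  exact ⟨iInf ψ, .iInf hψ, fun N _ b => by simp [Realize, e]⟩

theorem IsQF.upTo_e {φ : InfFormula L n} (h : IsQF φ) (hα : 1 ≤ α) :
    UpTo.{u, v, w} (IsE α) φ := by
  rcases hα.eq_or_lt with rfl | hα
  · exact (h.upTo_sigma 1).e_one
  · exact (h.upTo_pi 1).a_one.a_bar.e_of_lt hα

theorem IsQF.upTo_a {φ : InfFormula L n} (h : IsQF φ) (hα : 1 ≤ α) :
    UpTo.{u, v, w} (IsA α) φ := by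
  rcases hα.eq_or_lt with rfl | hα
  · exact (h.upTo_pi 1).a_one
  · exact (h.upTo_sigma 1).e_one.e_bar.a_of_lt hα

variable (α) in
theorem isE_isA_neg :
    (∀ {n : ℕ} {φ : InfFormula L n}, IsE α φ → UpTo.{u, v, w} (IsA α) φ.neg) ∧
    (∀ {n : ℕ} {φ : InfFormula L n}, IsA α φ → UpTo.{u, v, w} (IsE α) φ.neg) ∧
    (∀ {n : ℕ} {φ : InfFormula L n}, IsEBar α φ → UpTo.{u, v, w} (IsABar α) φ.neg) ∧
    (∀ {n : ℕ} {φ : InfFormula L n}, IsABar α φ → UpTo.{u, v, w} (IsEBar α) φ.neg) := by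
  induction α using WellFoundedLT.induction with
  | ind α ih =>
    have hE : ∀ {n : ℕ} {φ : InfFormula L n}, IsE α φ → UpTo.{u, v, w} (IsA α) φ.neg :=
      fun h => IsE.induction (motive := fun φ => UpTo.{u, v, w} (IsA α) φ.neg)
        (fun hα h => h.neg.upTo_a hα.ge) (fun hβ h => ((ih _ hβ).2.2.2 h).a_of_lt hβ)
        (fun h => (UpTo.a_all h).congr fun N _ b => by simp [Realize])
        (fun h => (UpTo.a_iInf h).congr fun N _ b => by simp [Realize]) h
    have hA : ∀ {n : ℕ} {φ : InfFormula L n}, IsA α φ → UpTo.{u, v, w} (IsE α) φ.neg :=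
      fun h => IsA.induction (motive := fun φ => UpTo.{u, v, w} (IsE α) φ.neg)
        (fun hα h => h.neg.upTo_e hα.ge) (fun hβ h => ((ih _ hβ).2.2.1 h).e_of_lt hβ)
        (fun h => (UpTo.e_ex h).congr fun N _ b => by simp [Realize])
        (fun h => (UpTo.e_iSup h).congr fun N _ b => by simp [Realize]) h
    refine ⟨hE, hA, fun h => ?_, fun h => ?_⟩
    · exact IsEBar.induction (motive := fun φ => UpTo.{u, v, w} (IsABar α) φ.neg)
        (fun h => (hE h).a_bar)
        (fun h => (UpTo.aBar_iInf h).congr fun N _ b => by simp [Realize])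
        (fun h => (UpTo.aBar_iSup h).congr fun N _ b => by simp [Realize]) h
    · exact IsABar.induction (motive := fun φ => UpTo.{u, v, w} (IsEBar α) φ.neg)
        (fun h => (hA h).e_bar)
        (fun h => (UpTo.eBar_iInf h).congr fun N _ b => by simp [Realize])
        (fun h => (UpTo.eBar_iSup h).congr fun N _ b => by simp [Realize]) h

theorem UpTo.neg_e {φ : InfFormula L n} (h : UpTo.{u, v, w} (IsE α) φ) :
    UpTo.{u, v, w} (IsA α) φ.neg := by
  obtain ⟨ψ, hψ, e⟩ := h
  exact ((isE_isA_neg α).1 hψ).congr fun N _ b => by simp [e]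

theorem UpTo.neg_a {φ : InfFormula L n} (h : UpTo.{u, v, w} (IsA α) φ) :
    UpTo.{u, v, w} (IsE α) φ.neg := by
  obtain ⟨ψ, hψ, e⟩ := h
  exact ((isE_isA_neg α).2.1 hψ).congr fun N _ b => by simp [e]

variable (α) in
theorem isE_isA_rename :
    (∀ {n : ℕ} {φ : InfFormula L n}, IsE α φ → ∀ {m : ℕ} (f : Fin n → Fin m),
      UpTo.{u, v, w} (IsE α) (φ.rename f)) ∧
    (∀ {n : ℕ} {φ : InfFormula L n}, IsA α φ → ∀ {m : ℕ} (f : Fin n → Fin m),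
      UpTo.{u, v, w} (IsA α) (φ.rename f)) ∧
    (∀ {n : ℕ} {φ : InfFormula L n}, IsEBar α φ → ∀ {m : ℕ} (f : Fin n → Fin m),
      UpTo.{u, v, w} (IsEBar α) (φ.rename f)) ∧
    (∀ {n : ℕ} {φ : InfFormula L n}, IsABar α φ → ∀ {m : ℕ} (f : Fin n → Fin m),
      UpTo.{u, v, w} (IsABar α) (φ.rename f)) := by
  induction α using WellFoundedLT.induction with
  | ind α ih =>
    have hE : ∀ {n : ℕ} {φ : InfFormula L n}, IsE α φ → ∀ {m : ℕ} (f : Fin n → Fin m),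
        UpTo.{u, v, w} (IsE α) (φ.rename f) :=
      fun h => IsE.induction
        (motive := fun {n} φ => ∀ {m : ℕ} (f : Fin n → Fin m), UpTo.{u, v, w} (IsE α) (φ.rename f))
        (fun hα h _ f => (h.rename f).upTo_e hα.ge)
        (fun hβ h _ f => ((ih _ hβ).2.2.2 h f).e_of_lt hβ)
        (fun h _ f => UpTo.e_ex (h _)) (fun h _ f => UpTo.e_iSup fun i => h i f) h
    have hA : ∀ {n : ℕ} {φ : InfFormula L n}, IsA α φ → ∀ {m : ℕ} (f : Fin n → Fin m),
        UpTo.{u, v, w} (IsA α) (φ.rename f) :=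
      fun h => IsA.induction
        (motive := fun {n} φ => ∀ {m : ℕ} (f : Fin n → Fin m), UpTo.{u, v, w} (IsA α) (φ.rename f))
        (fun hα h _ f => (h.rename f).upTo_a hα.ge)
        (fun hβ h _ f => ((ih _ hβ).2.2.1 h f).a_of_lt hβ)
        (fun h _ f => UpTo.a_all (h _)) (fun h _ f => UpTo.a_iInf fun i => h i f) h
    refine ⟨hE, hA, fun h => ?_, fun h => ?_⟩
    · exact IsEBar.induction
        (motive := fun {n} φ => ∀ {m : ℕ} (f : Fin n → Fin m),
          UpTo.{u, v, w} (IsEBar α) (φ.rename f))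
        (fun h _ f => (hE h f).e_bar) (fun h _ f => UpTo.eBar_iSup fun i => h i f)
        (fun h _ f => UpTo.eBar_iInf fun i => h i f) h
    · exact IsABar.induction
        (motive := fun {n} φ => ∀ {m : ℕ} (f : Fin n → Fin m),
          UpTo.{u, v, w} (IsABar α) (φ.rename f))
        (fun h _ f => (hA h f).a_bar) (fun h _ f => UpTo.aBar_iSup fun i => h i f)
        (fun h _ f => UpTo.aBar_iInf fun i => h i f) h

theorem UpTo.rename_e {φ : InfFormula L n} (h : UpTo.{u, v, w} (IsE α) φ) (f : Fin n → Fin m) :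
    UpTo.{u, v, w} (IsE α) (φ.rename f) := by
  obtain ⟨ψ, hψ, e⟩ := h
  exact ((isE_isA_rename α).1 hψ f).congr fun N _ b => by simp [realize_rename, e]

theorem UpTo.rename_aBar {φ : InfFormula L n} (h : UpTo.{u, v, w} (IsABar α) φ)
    (f : Fin n → Fin m) : UpTo.{u, v, w} (IsABar α) (φ.rename f) := by
  obtain ⟨ψ, hψ, e⟩ := h
  exact ((isE_isA_rename α).2.2.2 hψ f).congr fun N _ b => by simp [realize_rename, e]

theorem UpTo.mono_e {φ : InfFormula L n} (h : UpTo.{u, v, w} (IsE β) φ) (hβ : β ≤ α) :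
    UpTo.{u, v, w} (IsE α) φ := by
  obtain ⟨ψ, hψ, e⟩ := h
  refine UpTo.congr ?_ e
  have hα := hψ.one_le.trans hβ
  exact IsE.induction (motive := fun φ => UpTo.{u, v, w} (IsE α) φ) (fun _ h => h.upTo_e hα)
    (fun hγ h => .of (.of_lt (hγ.trans_le hβ) h)) UpTo.e_ex UpTo.e_iSup hψ

theorem UpTo.mono_a {φ : InfFormula L n} (h : UpTo.{u, v, w} (IsA β) φ) (hβ : β ≤ α) :
    UpTo.{u, v, w} (IsA α) φ :=
  (h.neg_a.mono_e hβ).neg_e.congr fun N _ b => by simp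

theorem IsABar.mono {φ : InfFormula L n} (h : IsABar β φ) (hβ : β ≤ α) :
    UpTo.{u, v, w} (IsABar α) φ :=
  IsABar.induction (motive := fun φ => UpTo.{u, v, w} (IsABar α) φ)
    (fun h => ((UpTo.of h).mono_a hβ).a_bar) UpTo.aBar_iSup UpTo.aBar_iInf h

/-- `𝔈_α` is closed under binary conjunctions: `∃` and disjunctions are pulled out of both
conjuncts, and a conjunction of an `𝔄̄_β` and an `𝔄̄_γ` formula is an `𝔄̄_{max β γ}` formula. -/
theorem UpTo.e_and {φ ψ : InfFormula L n} (hφ : UpTo.{u, v, w} (IsE α) φ)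
    (hψ : UpTo.{u, v, w} (IsE α) ψ) : UpTo.{u, v, w} (IsE α) (φ.and ψ) := by
  -- `G` is the class of the formulas from which `IsE.induction` generates `𝔈_α`
  let G : ∀ {n : ℕ}, InfFormula L n → Prop := fun φ =>
    α = 1 ∧ IsQF φ ∨ ∃ β < α, UpTo.{u, v, w} (IsABar β) φ
  have G_and : ∀ {n : ℕ} {φ ψ : InfFormula L n}, G φ → G ψ → UpTo.{u, v, w} (IsE α) (φ.and ψ) := by
    rintro n φ ψ (⟨hα, hφ⟩ | ⟨β, hβ, φ', hφ, eφ⟩) (⟨hα', hψ⟩ | ⟨γ, hγ, ψ', hψ, eψ⟩)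
    · have : IsQF (neg (imp φ (neg ψ))) := (IsQF.imp hφ hψ.neg).neg
      exact (this.upTo_e hα.ge).congr fun N _ b => by simp [Realize]
    · exact (hψ.one_le.not_gt (hα ▸ hγ)).elim
    · exact (hφ.one_le.not_gt (hα' ▸ hβ)).elim
    · refine UpTo.e_of_lt (UpTo.aBar_iInf fun i => ?_) (max_lt hβ hγ)
      split_ifs
      · exact (hφ.mono (le_max_left β γ)).congr eφ
      · exact (hψ.mono (le_max_right β γ)).congr eψ
  have G_rename : ∀ {n : ℕ} {φ : InfFormula L n}, G φ → ∀ {m : ℕ} (f : Fin n → Fin m),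
      G (φ.rename f) := by
    rintro n φ (⟨hα, hφ⟩ | ⟨β, hβ, hφ⟩) m f
    · exact .inl ⟨hα, hφ.rename f⟩
    · exact .inr ⟨β, hβ, hφ.rename_aBar f⟩
  have G_and_e : ∀ {n : ℕ} {ψ : InfFormula L n}, IsE α ψ → ∀ {φ : InfFormula L n}, G φ →
      UpTo.{u, v, w} (IsE α) (φ.and ψ) := by
    intro n ψ h
    refine IsE.induction (motive := fun {n} ψ => ∀ {φ : InfFormula L n}, G φ →
      UpTo.{u, v, w} (IsE α) (φ.and ψ)) ?_ ?_ ?_ ?_ h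
    · exact fun hα h φ hφ => G_and hφ (.inl ⟨hα, h⟩)
    · exact fun hβ h φ hφ => G_and hφ (.inr ⟨_, hβ, .of h⟩)
    · exact fun h φ hφ => (UpTo.e_ex (h (G_rename hφ Fin.castSucc))).congr
        fun N _ b => by simp [Realize, realize_rename]
    · exact fun h φ hφ => (UpTo.e_iSup fun i => h i hφ).congr fun N _ b => by simp [Realize]
  obtain ⟨φ', hφ', eφ⟩ := hφ
  have : UpTo.{u, v, w} (IsE α) (φ'.and ψ) := by
    refine IsE.induction (motive := fun {n} φ => ∀ {ψ : InfFormula L n}, UpTo.{u, v, w} (IsE α) ψ →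
      UpTo.{u, v, w} (IsE α) (φ.and ψ)) ?_ ?_ ?_ ?_ hφ' hψ
    · rintro n φ hα h ψ ⟨ψ', hψ, e⟩
      exact (G_and_e hψ (.inl ⟨hα, h⟩)).congr fun N _ b => by simp [e]
    · rintro β n φ hβ h ψ ⟨ψ', hψ, e⟩
      exact (G_and_e hψ (.inr ⟨_, hβ, .of h⟩)).congr fun N _ b => by simp [e]
    · exact fun h ψ hψ => (UpTo.e_ex (h (hψ.rename_e Fin.castSucc))).congr
        fun N _ b => by simp [Realize, realize_rename]
    · exact fun h ψ hψ => (UpTo.e_iSup fun i => h i hψ).congr fun N _ b => by simp [Realize]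
  exact this.congr fun N _ b => by simp [eφ]

theorem UpTo.e_exists_finite_and (hα : 1 ≤ α) {ι : Type*} [Finite ι] {φ : ι → InfFormula L n}
    (h : ∀ i, UpTo.{u, v, w} (IsE α) (φ i)) :
    ∃ ψ : InfFormula L n, UpTo.{u, v, w} (IsE α) ψ ∧
      ∀ (N : Type w) [L.Structure N] (b : Fin n → N), ψ.Realize b ↔ ∀ i, (φ i).Realize b := by
  have key : ∀ s : Set ι, s.Finite → ∃ ψ : InfFormula L n, UpTo.{u, v, w} (IsE α) ψ ∧
      ∀ (N : Type w) [L.Structure N] (b : Fin n → N), ψ.Realize b ↔ ∀ i ∈ s, (φ i).Realize b := by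
    intro s hs
    induction s, hs using Set.Finite.induction_on with
    | empty => exact ⟨neg falsum, IsQF.falsum.neg.upTo_e hα, fun N _ b => by simp [Realize]⟩
    | @insert i s _ _ ih =>
      obtain ⟨ψ, hψ, e⟩ := ih
      exact ⟨(φ i).and ψ, (h i).e_and hψ, fun N _ b => by simp [e]⟩
  obtain ⟨ψ, hψ, e⟩ := key Set.univ Set.finite_univ
  exact ⟨ψ, hψ, fun N _ b => by simp [e]⟩

variable (α) in
theorem isSigma_isPi_upTo_e_a (hα : 1 ≤ α) :
    (∀ {n : ℕ} {φ : InfFormula L n}, IsSigma α φ → UpTo.{u, v, w} (IsE α) φ) ∧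
      ∀ {n : ℕ} {φ : InfFormula L n}, IsPi α φ → UpTo.{u, v, w} (IsA α) φ := by
  induction α using WellFoundedLT.induction with
  | ind α ih =>
    refine ⟨fun {n φ} h => ?_, fun {n φ} h => ?_⟩
    · cases h with
      | qf h => simp at hα
      | iSup_exs k ψ β hβ h =>
        refine UpTo.e_iSup fun i => exs_induction
          (motive := fun φ => UpTo.{u, v, w} (IsE α) φ) UpTo.e_ex _ ?_
        have h := h i
        have hβ := hβ i
        generalize β i = γ at h hβ
        rcases eq_zero_or_pos γ with rfl | hγ
        · exact (isQF_of_isPi_zero h).upTo_e hα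
        · exact ((ih _ hβ (Order.one_le_iff_pos.2 hγ)).2 h).a_bar.e_of_lt hβ
    · cases h with
      | qf h => simp at hα
      | iInf_alls k ψ β hβ h =>
        refine UpTo.a_iInf fun i => alls_induction
          (motive := fun φ => UpTo.{u, v, w} (IsA α) φ) UpTo.a_all _ ?_
        have h := h i
        have hβ := hβ i
        generalize β i = γ at h hβ
        rcases eq_zero_or_pos γ with rfl | hγ
        · exact (isQF_of_isSigma_zero h).upTo_a hα
        · exact ((ih _ hβ (Order.one_le_iff_pos.2 hγ)).1 h).e_bar.a_of_lt hβ

/-- A `Π_{α+1}` formula is equivalent to a `∀𝔈_α` formula. -/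
theorem IsPi.upTo_forallE {φ : InfFormula L n} (h : IsPi (α + 1) φ) (hα : 1 ≤ α) :
    UpTo.{u, v, w} (IsForallE α) φ := by
  generalize hδ : α + 1 = δ at h
  cases h with
  | qf h => simp at hδ
  | iInf_alls k ψ β hβ h =>
    subst hδ
    have : ∀ i, UpTo.{u, v, w} (IsE α) (ψ i) := by
      intro i
      have h := h i
      have hβ := Order.lt_add_one_iff.1 (hβ i)
      generalize β i = γ at h hβ
      rcases eq_zero_or_pos γ with rfl | hγ
      · exact (isQF_of_isSigma_zero h).upTo_e hα
      · exact ((isSigma_isPi_upTo_e_a γ (Order.one_le_iff_pos.2 hγ)).1 h).mono_e hβ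
    choose χ hχ e using this
    exact ⟨_, ⟨k, χ, hχ, rfl⟩, fun N _ b => by simp [Realize, realize_alls, e]⟩

end Closure

/-! ### Omitting types -/

section Generic

/-- Existence of generic filters: for a countable family of sets `D` of subsets of `X`, each dense
below every condition, some proper filter has an element in every `D` of the family. -/
theorem exists_generic_filter {X : Type*} (P : Set X → Prop) (hP : ∀ S, P S → S.Nonempty)
    {S₀ : Set X} (hS₀ : P S₀) (𝒟 : Set (Set (Set X))) (h𝒟 : 𝒟.Countable)
    (dense : ∀ D ∈ 𝒟, ∀ S, P S → ∃ S' ⊆ S, P S' ∧ S' ∈ D) :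
    ∃ 𝓕 : Filter X, 𝓕.NeBot ∧ ∀ D ∈ 𝒟, ∃ S ∈ D, S ∈ 𝓕 := by
  rcases 𝒟.eq_empty_or_nonempty with rfl | hne
  · exact ⟨Filter.principal S₀, Filter.principal_neBot_iff.2 (hP _ hS₀), by simp⟩
  obtain ⟨D, rfl⟩ := h𝒟.exists_eq_range hne
  choose! next next_subset P_next next_mem using fun i => dense (D i) ⟨i, rfl⟩
  let S : ℕ → Set X := fun i => Nat.rec S₀ (fun i T => next i T) i
  have hS : ∀ i, P (S i) := fun i => by
    induction i with
    | zero => exact hS₀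
    | succ i ih => exact P_next i _ ih
  have anti : Antitone S := antitone_nat_of_succ_le fun i => next_subset i _ (hS i)
  refine ⟨⨅ i, Filter.principal (S i), ?_, ?_⟩
  · refine Filter.iInf_neBot_of_directed' ?_ fun i => Filter.principal_neBot_iff.2 (hP _ (hS i))
    exact directed_of_isDirected_le fun i j hij => Filter.principal_mono.2 (anti hij)
  · rintro _ ⟨i, rfl⟩
    exact ⟨S (i + 1), next_mem i _ (hS i),
      Filter.mem_iInf_of_mem (i + 1) (Filter.mem_principal_self _)⟩

end Generic

section Henkin

variable {M : Type w}

/-- Two constants are identified if almost all valuations, in the sense of `𝓕`, give them the same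
value. -/
def henkinSetoid (𝓕 : Filter (ℕ → M)) : Setoid ℕ where
  r i j := ∀ᶠ v in 𝓕, v i = v j
  iseqv :=
    { refl := fun _ => .of_forall fun _ => rfl
      symm := fun h => h.mono fun _ => Eq.symm
      trans := fun h h' => by filter_upwards [h, h'] with v using Eq.trans }

/-- The structure whose elements are constants `0, 1, 2, …` and whose relations hold if they hold
under almost all valuations of the constants in `M`, in the sense of the filter `𝓕`.  It is lifted
to the universe of `M`. -/
def Henkin (𝓕 : Filter (ℕ → M)) : Type w := ULift.{w} (Quotient (henkinSetoid 𝓕))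

/-- The element of `Henkin 𝓕` named by the constant `i`. -/
def Henkin.mk (𝓕 : Filter (ℕ → M)) (i : ℕ) : Henkin 𝓕 := ⟨Quotient.mk _ i⟩

variable {𝓕 : Filter (ℕ → M)}

theorem Henkin.mk_surjective : Function.Surjective (Henkin.mk 𝓕) := by
  rintro ⟨x⟩
  obtain ⟨i, rfl⟩ := Quotient.exists_rep x
  exact ⟨i, rfl⟩

instance : Countable (Henkin 𝓕) := Henkin.mk_surjective.countable

theorem Henkin.mk_eq_mk {i j : ℕ} : Henkin.mk 𝓕 i = Henkin.mk 𝓕 j ↔ ∀ᶠ v in 𝓕, v i = v j :=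
  ULift.up_injective.eq_iff.trans Quotient.eq

variable [L.IsRelational] [L.Structure M]

instance : L.Structure (Henkin 𝓕) where
  funMap f := isEmptyElim f
  RelMap R x := ∀ᶠ v in 𝓕, Language.Structure.RelMap R fun i => v (x i).down.out

theorem Henkin.relMap_mk {k : ℕ} (R : L.Relations k) (t : Fin k → ℕ) :
    Language.Structure.RelMap R (fun i => Henkin.mk 𝓕 (t i)) ↔
      ∀ᶠ v in 𝓕, Language.Structure.RelMap R fun i => v (t i) := by
  have h : ∀ᶠ v in 𝓕, ∀ i, v (Henkin.mk 𝓕 (t i)).down.out = v (t i) :=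
    Filter.eventually_all.2 fun i => Quotient.mk_out (s := henkinSetoid 𝓕) (t i)
  refine Filter.eventually_congr (h.mono fun v hv => ?_)
  simp only [hv]

end Henkin

section Forcing

variable {M : Type w} [L.Structure M] {α : Ordinal.{0}} {n : ℕ}

variable (L) in
/-- The forcing conditions: nonempty sets of valuations of the constants which are given by an `𝔈_α`
formula about finitely many constants. -/
def IsCondition (α : Ordinal.{0}) (S : Set (ℕ → M)) : Prop :=
  S.Nonempty ∧ ∃ (m : ℕ) (θ : InfFormula L m) (s : Fin m → ℕ),
    UpTo.{u, v, w} (IsE α) θ ∧ S = {v | θ.Realize fun i => v (s i)}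

variable (L) in
/-- Density of a set of sets of valuations with respect to the forcing conditions. -/
def IsDenseSet (α : Ordinal.{0}) (D : Set (Set (ℕ → M))) : Prop :=
  ∀ S, IsCondition L α S → ∃ S' ⊆ S, IsCondition L α S' ∧ S' ∈ D

theorem append_comp_append {N ι : Type*} {m n : ℕ} (v : ι → N) (s : Fin m → ι) (t : Fin n → ι) :
    (fun i => v (Fin.append s t i)) = Fin.append (fun i => v (s i)) fun i => v (t i) := by
  funext i
  induction i using Fin.addCases <;> simp

theorem snoc_comp {N ι : Type*} {n : ℕ} (v : ι → N) (t : Fin n → ι) (j : ι) :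
    (fun i => v ((Fin.snoc t j : Fin (n + 1) → ι) i)) =
      (Fin.snoc (fun i => v (t i)) (v j) : Fin (n + 1) → N) := by
  funext i
  induction i using Fin.lastCases <;> simp

theorem IsCondition.inter {S : Set (ℕ → M)} (hS : IsCondition L α S) {φ : InfFormula L n}
    (hφ : UpTo.{u, v, w} (IsE α) φ) (t : Fin n → ℕ)
    (hne : ∃ v ∈ S, φ.Realize fun i => v (t i)) :
    IsCondition L α (S ∩ {v | φ.Realize fun i => v (t i)}) := by
  obtain ⟨-, m, θ, s, hθ, rfl⟩ := hS
  refine ⟨hne, m + n, (θ.rename (Fin.castAdd n)).and (φ.rename (Fin.natAdd m)), Fin.append s t,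
    (hθ.rename_e _).e_and (hφ.rename_e _), ?_⟩
  ext v
  simp [realize_rename]

/-- The set of values that a condition allows for a tuple of constants is defined by an `𝔈_α`
formula. -/
theorem IsCondition.exists_projection (hα : 1 ≤ α) {S : Set (ℕ → M)} (hS : IsCondition L α S)
    (t : Fin n → ℕ) : ∃ φ : InfFormula L n, IsE α φ ∧
      ∀ b : Fin n → M, φ.Realize b ↔ ∃ v ∈ S, b = fun i => v (t i) := by
  obtain ⟨⟨v₀, -⟩, m, θ, s, hθ, rfl⟩ := hS
  -- the values of the constants `t, s` come from a valuation iff repeated constants agree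
  let r : Fin (n + m) → ℕ := Fin.append t s
  obtain ⟨χ, hχ, eχ⟩ := UpTo.e_exists_finite_and (L := L) hα
    (φ := fun p : {p : Fin (n + m) × Fin (n + m) // r p.1 = r p.2} => equal p.1.1 p.1.2)
    fun p => (IsQF.equal _ _).upTo_e hα
  obtain ⟨φ, hφ, e⟩ := exs_induction (motive := fun φ => UpTo.{u, v, w} (IsE α) φ) UpTo.e_ex m
    (hχ.e_and (hθ.rename_e (Fin.natAdd n)))
  refine ⟨φ, hφ, fun b => ?_⟩
  rw [← e]
  simp only [realize_exs, realize_and, realize_rename, eχ, Realize, Fin.append_right,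
    Set.mem_ofPred_eq, Subtype.forall, Prod.forall]
  constructor
  · rintro ⟨y, hy, hθ⟩
    have hr : Function.FactorsThrough (Fin.append b y) r := fun i j hij => hy i j hij
    have hv : ∀ i, Function.extend r (Fin.append b y) v₀ (r i) = Fin.append b y i :=
      fun i => hr.extend_apply _ i
    refine ⟨Function.extend r (Fin.append b y) v₀, ?_, ?_⟩
    · convert hθ using 2 with i
      simpa [r] using hv (Fin.natAdd n i)
    · funext i
      simpa [r] using (hv (Fin.castAdd m i)).symm
  · rintro ⟨v, hv, rfl⟩
    refine ⟨fun i => v (s i), fun i j hij => ?_, hv⟩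
    rw [← append_comp_append v]
    exact congrArg v hij

theorem isDenseSet_decide {φ : InfFormula L n} (h : UpTo.{u, v, w} (IsE α) φ)
    (h' : UpTo.{u, v, w} (IsE α) φ.neg) (t : Fin n → ℕ) :
    IsDenseSet L α {S : Set (ℕ → M) | (∀ v ∈ S, φ.Realize fun i => v (t i)) ∨
      ∀ v ∈ S, ¬ φ.Realize fun i => v (t i)} := by
  intro S hS
  obtain ⟨v, hv⟩ := hS.1
  by_cases hφ : φ.Realize fun i => v (t i)
  · exact ⟨_, Set.inter_subset_left, hS.inter h t ⟨v, hv, hφ⟩, .inl fun v hv => hv.2⟩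
  · exact ⟨_, Set.inter_subset_left, hS.inter h' t ⟨v, hv, hφ⟩, .inr fun v hv => hv.2⟩

variable [L.IsRelational]

variable (M) in
/-- `φ` is preserved from the forcing relation to the Henkin structure of every filter that is
sufficiently generic, i.e. that meets countably many dense sets which depend only on `φ`. -/
def IsForcible (α : Ordinal.{0}) (φ : InfFormula L n) : Prop :=
  ∃ 𝒟 : Set (Set (Set (ℕ → M))), 𝒟.Countable ∧ (∀ D ∈ 𝒟, IsDenseSet L α D) ∧
    ∀ 𝓕 : Filter (ℕ → M), 𝓕.NeBot → (∀ D ∈ 𝒟, ∃ S ∈ D, S ∈ 𝓕) → ∀ t : Fin n → ℕ,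
      (∀ᶠ v in 𝓕, φ.Realize fun i => v (t i)) → φ.Realize fun i => Henkin.mk 𝓕 (t i)

/-- For quantifier-free formulas, truth in the Henkin structure coincides with truth under almost
all valuations. -/
theorem IsQF.exists_dense (hα : 1 ≤ α) {φ : InfFormula L n} (h : IsQF φ) :
    ∃ 𝒟 : Set (Set (Set (ℕ → M))), 𝒟.Countable ∧ (∀ D ∈ 𝒟, IsDenseSet L α D) ∧
      ∀ 𝓕 : Filter (ℕ → M), 𝓕.NeBot → (∀ D ∈ 𝒟, ∃ S ∈ D, S ∈ 𝓕) → ∀ t : Fin n → ℕ,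
        ∀ᶠ v in 𝓕, ((φ.Realize fun i => v (t i)) ↔ φ.Realize fun i => Henkin.mk 𝓕 (t i)) := by
  have atomic : ∀ {n : ℕ} {φ : InfFormula L n}, IsQF φ →
      (∀ (𝓕 : Filter (ℕ → M)) (t : Fin n → ℕ), (φ.Realize fun i => Henkin.mk 𝓕 (t i)) ↔
        ∀ᶠ v in 𝓕, φ.Realize fun i => v (t i)) →
      ∃ 𝒟 : Set (Set (Set (ℕ → M))), 𝒟.Countable ∧ (∀ D ∈ 𝒟, IsDenseSet L α D) ∧
        ∀ 𝓕 : Filter (ℕ → M), 𝓕.NeBot → (∀ D ∈ 𝒟, ∃ S ∈ D, S ∈ 𝓕) → ∀ t : Fin n → ℕ,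
          ∀ᶠ v in 𝓕, ((φ.Realize fun i => v (t i)) ↔ φ.Realize fun i => Henkin.mk 𝓕 (t i)) := by
    intro n φ hφ h
    refine ⟨Set.range _, Set.countable_range _, Set.forall_mem_range.2
      (isDenseSet_decide (hφ.upTo_e hα) (hφ.neg.upTo_e hα)), fun 𝓕 _ hg t => ?_⟩
    obtain ⟨S, hS | hS, hS𝓕⟩ := hg _ ⟨t, rfl⟩
    · have := (h 𝓕 t).2 (Filter.mem_of_superset hS𝓕 hS)
      filter_upwards [hS𝓕] with v hv
      simp only [hS v hv, this]
    · have : ¬ φ.Realize fun i => Henkin.mk 𝓕 (t i) := fun hc => by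
        obtain ⟨v, hv, hv'⟩ := (((h 𝓕 t).1 hc).and hS𝓕).exists
        exact hS v hv' hv
      filter_upwards [hS𝓕] with v hv
      simp only [hS v hv, this]
  induction h with
  | falsum => exact ⟨∅, Set.countable_empty, by simp, fun _ _ _ _ => by simp [Realize]⟩
  | equal i j => exact atomic (.equal i j) fun 𝓕 t => Henkin.mk_eq_mk
  | rel R t => exact atomic (.rel R t) fun 𝓕 s => Henkin.relMap_mk R fun i => s (t i)
  | imp _ _ h₁ h₂ =>
    obtain ⟨𝒟₁, c₁, d₁, h₁⟩ := h₁
    obtain ⟨𝒟₂, c₂, d₂, h₂⟩ := h₂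
    refine ⟨𝒟₁ ∪ 𝒟₂, c₁.union c₂, fun D hD => hD.elim (d₁ D) (d₂ D), fun 𝓕 _ hg t => ?_⟩
    filter_upwards [h₁ 𝓕 ‹_› (fun D hD => hg D (.inl hD)) t,
      h₂ 𝓕 ‹_› (fun D hD => hg D (.inr hD)) t] with v e₁ e₂
    simp only [Realize, e₁, e₂]

theorem IsQF.isForcible (hα : 1 ≤ α) {φ : InfFormula L n} (h : IsQF φ) : IsForcible M α φ := by
  obtain ⟨𝒟, c, d, h⟩ := h.exists_dense (M := M) hα
  refine ⟨𝒟, c, d, fun 𝓕 _ hg t hφ => ?_⟩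
  obtain ⟨v, hv, e⟩ := (hφ.and (h 𝓕 ‹_› hg t)).exists
  exact e.1 hv

theorem IsForcible.iInf {φ : ℕ → InfFormula L n} (h : ∀ i, IsForcible M α (φ i)) :
    IsForcible M α (iInf φ) := by
  choose 𝒟 c d h using h
  refine ⟨⋃ i, 𝒟 i, Set.countable_iUnion c, fun D hD => ?_, fun 𝓕 _ hg t hφ i => ?_⟩
  · obtain ⟨i, hi⟩ := Set.mem_iUnion.1 hD
    exact d i D hi
  · exact h i 𝓕 ‹_› (fun D hD => hg D (Set.mem_iUnion.2 ⟨i, hD⟩)) t (hφ.mono fun v hv => hv i)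

theorem IsForcible.all {φ : InfFormula L (n + 1)} (h : IsForcible M α φ) :
    IsForcible M α (all φ) := by
  obtain ⟨𝒟, c, d, h⟩ := h
  refine ⟨𝒟, c, d, fun 𝓕 _ hg t hφ x => ?_⟩
  obtain ⟨j, rfl⟩ := Henkin.mk_surjective x
  rw [← snoc_comp (Henkin.mk 𝓕)]
  refine h 𝓕 ‹_› hg _ (hφ.mono fun v hv => ?_)
  rw [snoc_comp v]
  exact hv _

theorem IsForcible.iSup {φ : ℕ → InfFormula L n} (h : ∀ i, IsForcible M α (φ i))
    (hE : ∀ i, UpTo.{u, v, w} (IsE α) (φ i)) : IsForcible M α (iSup φ) := by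
  choose 𝒟 c d h using h
  let D₀ : (Fin n → ℕ) → Set (Set (ℕ → M)) := fun t =>
    {S | (∀ v ∈ S, ¬ (InfFormula.iSup φ).Realize fun i => v (t i)) ∨
      ∃ j, ∀ v ∈ S, (φ j).Realize fun i => v (t i)}
  refine ⟨Set.range D₀ ∪ ⋃ i, 𝒟 i, (Set.countable_range _).union (Set.countable_iUnion c),
    fun D hD => ?_, fun 𝓕 _ hg t hφ => ?_⟩
  · rcases hD with ⟨t, rfl⟩ | hD
    · intro S hS
      by_cases hne : ∃ v ∈ S, (InfFormula.iSup φ).Realize fun i => v (t i)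
      · obtain ⟨v, hv, j, hj⟩ := hne
        exact ⟨_, Set.inter_subset_left, hS.inter (hE j) t ⟨v, hv, hj⟩, .inr ⟨j, fun v hv => hv.2⟩⟩
      · exact ⟨S, subset_rfl, hS, .inl fun v hv hc => hne ⟨v, hv, hc⟩⟩
    · obtain ⟨i, hi⟩ := Set.mem_iUnion.1 hD
      exact d i D hi
  · obtain ⟨S, hS | ⟨j, hS⟩, hS𝓕⟩ := hg _ (.inl ⟨t, rfl⟩)
    · obtain ⟨v, hv, hv'⟩ := (hφ.and hS𝓕).exists
      exact (hS v hv' hv).elim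
    · exact ⟨j, h j 𝓕 ‹_› (fun D hD => hg D (.inr (Set.mem_iUnion.2 ⟨j, hD⟩))) t
        (Filter.mem_of_superset hS𝓕 hS)⟩

theorem IsForcible.ex {φ : InfFormula L (n + 1)} (h : IsForcible M α φ)
    (hE : UpTo.{u, v, w} (IsE α) φ) : IsForcible M α (ex φ) := by
  obtain ⟨𝒟, c, d, h⟩ := h
  let D₀ : (Fin n → ℕ) → Set (Set (ℕ → M)) := fun t =>
    {S | (∀ v ∈ S, ¬ (InfFormula.ex φ).Realize fun i => v (t i)) ∨
      ∃ j, ∀ v ∈ S, φ.Realize fun i => v ((Fin.snoc t j : Fin (n + 1) → ℕ) i)}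
  refine ⟨Set.range D₀ ∪ 𝒟, (Set.countable_range _).union c, fun D hD => ?_,
    fun 𝓕 _ hg t hφ => ?_⟩
  · rcases hD with ⟨t, rfl⟩ | hD
    · intro S hS
      by_cases hne : ∃ v ∈ S, (InfFormula.ex φ).Realize fun i => v (t i)
      · obtain ⟨v, hv, x, hx⟩ := hne
        have hS' := hS
        obtain ⟨-, m, θ, s, hθ, rfl⟩ := hS
        -- a constant `j` that is not mentioned yet may be given the value `x`
        obtain ⟨j, hj⟩ := (Set.finite_range (Fin.append s t)).exists_notMem
        have hjs : ∀ i, s i ≠ j := fun i hi => hj ⟨Fin.castAdd n i, by simpa using hi⟩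
        have hjt : ∀ i, t i ≠ j := fun i hi => hj ⟨Fin.natAdd m i, by simpa using hi⟩
        refine ⟨_, Set.inter_subset_left, hS'.inter hE (Fin.snoc t j)
          ⟨Function.update v j x, ?_, ?_⟩, .inr ⟨j, fun v hv => hv.2⟩⟩
        · simpa [Function.update_of_ne (hjs _)] using hv
        · rw [snoc_comp]
          simpa [Function.update_of_ne (hjt _)] using hx
      · exact ⟨S, subset_rfl, hS, .inl fun v hv hc => hne ⟨v, hv, hc⟩⟩
    · exact d D hD
  · obtain ⟨S, hS | ⟨j, hS⟩, hS𝓕⟩ := hg _ (.inl ⟨t, rfl⟩)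
    · obtain ⟨v, hv, hv'⟩ := (hφ.and hS𝓕).exists
      exact (hS v hv' hv).elim
    · refine ⟨Henkin.mk 𝓕 j, ?_⟩
      rw [← snoc_comp (Henkin.mk 𝓕)]
      exact h 𝓕 ‹_› (fun D hD => hg D (.inr hD)) _ (Filter.mem_of_superset hS𝓕 hS)

/-- The truth lemma.  Passing from `∃` or a countable disjunction to a witness needs the subformulas
to be `𝔈_α`; for `𝔈̄_β` formulas this is guaranteed only if `β + 1 < α`, but only these occur inside
the `𝔄_γ` formulas with `γ < α`. -/
theorem isForcible_of_le (hα : 1 ≤ α) (β : Ordinal.{0}) :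
    (β ≤ α → ∀ {n : ℕ} {φ : InfFormula L n}, IsE β φ → IsForcible M α φ) ∧
    (β < α → ∀ {n : ℕ} {φ : InfFormula L n}, IsA β φ → IsForcible M α φ) ∧
    ((∃ γ, β < γ ∧ γ < α) → ∀ {n : ℕ} {φ : InfFormula L n}, IsEBar β φ → IsForcible M α φ) ∧
    (β < α → ∀ {n : ℕ} {φ : InfFormula L n}, IsABar β φ → IsForcible M α φ) := by
  induction β using WellFoundedLT.induction with
  | ind β ih =>
    have hE : β ≤ α → ∀ {n : ℕ} {φ : InfFormula L n}, IsE β φ → IsForcible M α φ := by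
      intro hβ n φ h
      refine (IsE.induction
        (motive := fun φ => IsForcible M α φ ∧ UpTo.{u, v, w} (IsE α) φ) ?_ ?_ ?_ ?_ h).1
      · exact fun _ h => ⟨h.isForcible hα, h.upTo_e hα⟩
      · exact fun hγ h => ⟨(ih _ hγ).2.2.2 (hγ.trans_le hβ) h, .of (.of_lt (hγ.trans_le hβ) h)⟩
      · exact fun h => ⟨h.1.ex h.2, h.2.e_ex⟩
      · exact fun h => ⟨.iSup (fun i => (h i).1) fun i => (h i).2, UpTo.e_iSup fun i => (h i).2⟩
    have hA : β < α → ∀ {n : ℕ} {φ : InfFormula L n}, IsA β φ → IsForcible M α φ := by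
      intro hβ n φ h
      exact IsA.induction (motive := fun φ => IsForcible M α φ) (fun _ h => h.isForcible hα)
        (fun hγ h => (ih _ hγ).2.2.1 ⟨β, hγ, hβ⟩ h) .all .iInf h
    refine ⟨hE, hA, ?_, ?_⟩
    · rintro ⟨γ, hβ, hγ⟩ n φ h
      refine (IsEBar.induction (motive := fun φ => IsForcible M α φ ∧ IsEBar β φ) ?_ ?_ ?_ h).1
      · exact fun h => ⟨hE (hβ.trans hγ).le h, .of_isE h⟩
      · exact fun h => ⟨.iSup (fun i => (h i).1) fun i =>
          .of (.of_lt hγ (.of_isA (.of_lt hβ (h i).2))), .iSup fun i => (h i).2⟩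
      · exact fun h => ⟨.iInf fun i => (h i).1, .iInf fun i => (h i).2⟩
    · intro hβ n φ h
      refine (IsABar.induction (motive := fun φ => IsForcible M α φ ∧ IsABar β φ) ?_ ?_ ?_ h).1
      · exact fun h => ⟨hA hβ h, .of_isA h⟩
      · exact fun h => ⟨.iSup (fun i => (h i).1) fun i => .of (.of_lt hβ (h i).2),
          .iSup fun i => (h i).2⟩
      · exact fun h => ⟨.iInf fun i => (h i).1, .iInf fun i => (h i).2⟩

/-- The omitting types theorem for `∀𝔈_α` sentences and `𝔄_α` types: a structure with a `∀𝔈_α` Scott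
sentence realizes only `𝔄_α` types which are supported by `𝔈_α` formulas. -/
theorem IsScottSentence.exists_supports [Countable M] (hα : 1 ≤ α) {T : InfFormula L 0}
    (hT : IsForallE α T) (hM : T.IsScottSentence M) (a : Fin n → M) :
    ∃ φ : InfFormula L n, IsE α φ ∧ φ.Supports M (typeA α a) := by
  rcases isEmpty_or_nonempty M with hM₀ | hM₀
  · -- `Henkin` structures are nonempty, but here there is just one tuple of length `n`
    obtain ⟨φ, hφ, e⟩ := (IsQF.falsum (L := L) (n := n)).neg.upTo_e (α := α) hα
    refine ⟨φ, hφ, ⟨a, by rw [← e]; simp [Realize]⟩, fun b _ ψ hψ => ?_⟩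
    rw [Subsingleton.elim b a]
    exact hψ.2
  by_contra! hp
  let p : Set (InfFormula L n) := typeA α a
  -- `χ b`, for a tuple `b` not realizing the type, is an `𝔈_α` formula witnessing that
  have hχ : ∀ b : {b : Fin n → M // ∃ ψ ∈ p, ¬ ψ.Realize b},
      ∃ χ : InfFormula L n, IsE α χ ∧ χ.Realize b.1 ∧ ∃ ψ ∈ p,
        ∀ (N : Type w) [L.Structure N] (c : Fin n → N), χ.Realize c → ¬ ψ.Realize c := by
    rintro ⟨b, ψ, hψ, hb⟩
    obtain ⟨χ, hχ, e⟩ := UpTo.neg_a (.of hψ.1)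
    exact ⟨χ, hχ, (e M b).1 hb, ψ, hψ, fun N _ c hc => (e N c).2 hc⟩
  choose χ χ_e χ_self χ_omit using hχ
  obtain ⟨k, ψ, hψ, rfl⟩ := hT
  have force : ∀ {n : ℕ} {φ : InfFormula L n}, IsE α φ → IsForcible M α φ :=
    (isForcible_of_le hα α).1 le_rfl
  obtain ⟨𝒟₁, c₁, d₁, h₁⟩ : IsForcible M α (iInf fun i => alls (k i) (ψ i)) :=
    .iInf fun i => alls_induction (motive := fun φ => IsForcible M α φ) .all _ (force (hψ i))
  choose 𝒟₂ c₂ d₂ h₂ using fun b => force (χ_e b)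
  let D₃ : (Fin n → ℕ) → Set (Set (ℕ → M)) := fun t =>
    {S | ∃ b : {b : Fin n → M // ∃ ψ ∈ p, ¬ ψ.Realize b},
      ∀ v ∈ S, (χ b).Realize fun i => v (t i)}
  have d₃ : ∀ t, IsDenseSet L α (D₃ t) := by
    intro t S hS
    obtain ⟨φ, hφ, e⟩ := hS.exists_projection hα t
    obtain ⟨v₀, hv₀⟩ := hS.1
    have := hp φ hφ
    simp only [Supports, not_and, not_forall] at this
    obtain ⟨b, hb, ψ, hψ, hbψ⟩ := this ⟨_, (e _).2 ⟨v₀, hv₀, rfl⟩⟩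
    obtain ⟨v, hv, rfl⟩ := (e b).1 hb
    exact ⟨_, Set.inter_subset_left, hS.inter (.of (χ_e ⟨_, ψ, hψ, hbψ⟩)) t
      ⟨v, hv, χ_self ⟨_, ψ, hψ, hbψ⟩⟩, _, fun v hv => hv.2⟩
  have hS₀ : IsCondition L α (Set.univ : Set (ℕ → M)) :=
    ⟨Set.univ_nonempty, 0, neg falsum, Fin.elim0, IsQF.falsum.neg.upTo_e hα,
      by ext; simp [Realize]⟩
  obtain ⟨𝓕, h𝓕, hg⟩ := exists_generic_filter (IsCondition L α) (fun S hS => hS.1) hS₀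
    (𝒟₁ ∪ ((⋃ b, 𝒟₂ b) ∪ Set.range D₃))
    (c₁.union ((Set.countable_iUnion c₂).union (Set.countable_range _))) (by
      rintro D (hD | hD | ⟨t, rfl⟩)
      · exact d₁ D hD
      · obtain ⟨b, hb⟩ := Set.mem_iUnion.1 hD
        exact d₂ b D hb
      · exact d₃ t)
  have hN : (iInf fun i => alls (k i) (ψ i)).Realize (Fin.elim0 : Fin 0 → Henkin 𝓕) := by
    have hMT := (hM M).2 ⟨Language.Equiv.refl L M⟩
    have := h₁ 𝓕 h𝓕 (fun D hD => hg D (.inl hD)) Fin.elim0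
      (.of_forall fun v => by rwa [Subsingleton.elim (fun i => v (Fin.elim0 i)) Fin.elim0])
    rwa [Subsingleton.elim (fun i => Henkin.mk 𝓕 (Fin.elim0 i)) Fin.elim0] at this
  obtain ⟨f⟩ := (hM (Henkin 𝓕)).1 hN
  choose t ht using fun i => Henkin.mk_surjective (f.symm (a i))
  obtain ⟨S, ⟨b, hS⟩, hS𝓕⟩ := hg _ (.inr (.inr ⟨t, rfl⟩))
  have hχ := h₂ b 𝓕 h𝓕 (fun D hD => hg D (.inr (.inl (Set.mem_iUnion.2 ⟨b, hD⟩)))) t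
    (Filter.mem_of_superset hS𝓕 hS)
  obtain ⟨ψ, hψ, hb⟩ := χ_omit b
  refine hb _ _ hχ ?_
  simp only [ht]
  exact (realize_equiv ψ f.symm a).2 hψ.2

end Forcing

end InfFormula

/-! ### Back-and-forth systems -/

section BackAndForth

variable {L : FirstOrder.Language.{u, v}} {M N : Type w} {n : ℕ}

/-- A pair of tuples of the same length which are related by `R`. -/
structure RelatedPair (R : ∀ n : ℕ, (Fin n → M) → (Fin n → N) → Prop) where
  length : ℕ
  left : Fin length → M
  right : Fin length → N
  rel : R length left right

/-- A pair of tuples `p` is below `q` if, as a finite relation between `M` and `N`, it is contained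
in `q`. -/
instance (R : ∀ n : ℕ, (Fin n → M) → (Fin n → N) → Prop) : Preorder (RelatedPair R) where
  le p q := ∀ i, ∃ j, q.left j = p.left i ∧ q.right j = p.right i
  le_refl _ i := ⟨i, rfl, rfl⟩
  le_trans p q r h h' i := by
    obtain ⟨j, e₁, e₂⟩ := h i
    obtain ⟨k, e₁', e₂'⟩ := h' j
    exact ⟨k, e₁'.trans e₁, e₂'.trans e₂⟩

/-- A back-and-forth system between countable structures of a relational language, each of whose
pairs preserves quantifier-free formulas, extends to an isomorphism. -/
theorem exists_equiv_of_backAndForth [L.IsRelational] [L.Structure M] [L.Structure N]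
    [Countable M] [Countable N] (R : ∀ n : ℕ, (Fin n → M) → (Fin n → N) → Prop)
    (qf : ∀ {n a b}, R n a b → ∀ {φ : InfFormula L n}, φ.IsQF → (φ.Realize a ↔ φ.Realize b))
    (forth : ∀ {n a b}, R n a b → ∀ x, ∃ y, R (n + 1) (Fin.snoc a x) (Fin.snoc b y))
    (back : ∀ {n a b}, R n a b → ∀ y, ∃ x, R (n + 1) (Fin.snoc a x) (Fin.snoc b y))
    {a : Fin n → M} {b : Fin n → N} (h : R n a b) : ∃ f : M ≃[L] N, b = f ∘ a := by
  have le_snoc : ∀ (p : RelatedPair R) (x : M) (y : N)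
      (h : R (p.length + 1) (Fin.snoc p.left x) (Fin.snoc p.right y)), p ≤ ⟨_, _, _, h⟩ :=
    fun p x y h i => ⟨i.castSucc, by simp, by simp⟩
  let D : M ⊕ N → Order.Cofinal (RelatedPair R) := Sum.elim
    (fun x => ⟨{p | ∃ i, p.left i = x}, fun p => by
      obtain ⟨y, h⟩ := forth p.rel x
      exact ⟨_, ⟨Fin.last _, by simp⟩, le_snoc p x y h⟩⟩)
    (fun y => ⟨{p | ∃ i, p.right i = y}, fun p => by
      obtain ⟨x, h⟩ := back p.rel y
      exact ⟨_, ⟨Fin.last _, by simp⟩, le_snoc p x y h⟩⟩)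
  have := Encodable.ofCountable (M ⊕ N)
  let p : ℕ → RelatedPair R := Order.sequenceOfCofinals ⟨n, a, b, h⟩ D
  have mono : Monotone p := Order.sequenceOfCofinals.monotone _ D
  -- `G` is the union of the pairs in the generic sequence `p`
  let G : M → N → Prop := fun x y => ∃ s i, (p s).left i = x ∧ (p s).right i = y
  have G_finite : ∀ {k : ℕ} (x : Fin k → M) (y : Fin k → N), (∀ i, G (x i) (y i)) →
      ∃ (s : ℕ) (j : Fin k → Fin (p s).length),
        (∀ i, (p s).left (j i) = x i) ∧ ∀ i, (p s).right (j i) = y i := by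
    intro k x y hG
    choose s i hx hy using hG
    obtain ⟨t, ht⟩ := (Set.finite_range s).bddAbove
    choose j hj hj' using fun l => mono (ht ⟨l, rfl⟩) (i l)
    exact ⟨t, j, fun l => (hj l).trans (hx l), fun l => (hj' l).trans (hy l)⟩
  have G_iff : ∀ {x x' y y'}, G x y → G x' y' → (x = x' ↔ y = y') := by
    intro x x' y y' hG hG'
    obtain ⟨s, j, hx, hy⟩ := G_finite ![x, x'] ![y, y'] (by simp [Fin.forall_fin_two, hG, hG'])
    have := qf (p s).rel (.equal (j 0) (j 1))
    simpa [InfFormula.Realize, hx, hy] using this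
  have G_left : ∀ x, ∃ y, G x y := fun x => by
    obtain ⟨i, hi⟩ := Order.sequenceOfCofinals.encode_mem ⟨n, a, b, h⟩ D (.inl x)
    exact ⟨_, _, i, hi, rfl⟩
  have G_right : ∀ y, ∃ x, G x y := fun y => by
    obtain ⟨i, hi⟩ := Order.sequenceOfCofinals.encode_mem ⟨n, a, b, h⟩ D (.inr y)
    exact ⟨_, _, i, rfl, hi⟩
  choose f hf using G_left
  have bij : Function.Bijective f := by
    refine ⟨fun x x' e => (G_iff (hf x) (hf x')).2 e, fun y => ?_⟩
    obtain ⟨x, hx⟩ := G_right y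
    exact ⟨x, (G_iff (hf x) hx).1 rfl⟩
  refine ⟨{ Equiv.ofBijective f bij with
    map_fun' := fun g => isEmptyElim g
    map_rel' := fun {k} r x => ?_ }, ?_⟩
  · obtain ⟨s, j, hx, hy⟩ := G_finite x (fun i => f (x i)) fun i => hf (x i)
    have := qf (p s).rel (.rel r j)
    simp only [InfFormula.Realize, hx, hy] at this
    exact this.symm
  · funext i
    exact ((G_iff (hf (a i)) ⟨0, i, rfl, rfl⟩).1 rfl).symm

end BackAndForth

namespace InfFormula

variable {L : FirstOrder.Language.{u, v}} {M : Type w} [L.Structure M] {α : Ordinal.{0}} {n : ℕ}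

/-! ### Definability of orbits -/

theorem mem_autOrbit_self (a : Fin n → M) : a ∈ autOrbit L a := ⟨Language.Equiv.refl L M, rfl⟩

theorem realize_of_mem_autOrbit {a b : Fin n → M} (h : b ∈ autOrbit L a) (φ : InfFormula L n) :
    φ.Realize b ↔ φ.Realize a := by
  obtain ⟨f, rfl⟩ := h
  exact realize_equiv φ f a

/-- If all `𝔄_α` types of tuples are supported by `𝔈_α` formulas, then these formulas define the
orbits: the pairs of a tuple `a` and a tuple satisfying the formula of `a` form a back-and-forth
system. -/
theorem exists_definedSet_eq_autOrbit [L.IsRelational] [Countable M]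
    (h : ∀ (n : ℕ) (a : Fin n → M), ∃ φ : InfFormula L n, IsE α φ ∧ φ.Supports M (typeA α a))
    (a : Fin n → M) : ∃ φ : InfFormula L n, IsE α φ ∧ φ.definedSet M = autOrbit L a := by
  choose φ φ_e φ_supp using h
  have type_of : ∀ {n} {a b : Fin n → M} {ψ : InfFormula L n}, (φ n a).Realize b →
      UpTo.{u, v, w} (IsA α) ψ → ψ.Realize a → ψ.Realize b := by
    rintro n a b ψ hb ⟨ψ', hψ', e⟩ hψ
    exact (e M b).2 ((φ_supp n a).2 b hb ψ' ⟨hψ', (e M a).1 hψ⟩)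
  -- otherwise, the negation of the supporting formula would belong to the type
  have φ_self : ∀ {n} (a : Fin n → M), (φ n a).Realize a := by
    intro n a
    by_contra hc
    obtain ⟨b, hb⟩ := (φ_supp n a).1
    exact type_of hb (UpTo.of (φ_e n a)).neg_e hc hb
  have φ_symm : ∀ {n} {a b : Fin n → M}, (φ n a).Realize b → (φ n b).Realize a := by
    intro n a b hb
    by_contra hc
    exact type_of hb (UpTo.of (φ_e n b)).neg_e hc (φ_self b)
  have type_iff : ∀ {n} {a b : Fin n → M} {ψ : InfFormula L n}, (φ n a).Realize b →
      UpTo.{u, v, w} (IsE α) ψ → (ψ.Realize a ↔ ψ.Realize b) := by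
    intro n a b ψ hb hψ
    refine ⟨fun ha => ?_, fun hb' => ?_⟩
    · by_contra hc
      exact type_of (φ_symm hb) hψ.neg_e hc ha
    · by_contra hc
      exact type_of hb hψ.neg_e hc hb'
  have forth : ∀ {n} {a b : Fin n → M}, (φ n a).Realize b → ∀ x, ∃ y,
      (φ (n + 1) (Fin.snoc a x)).Realize (Fin.snoc b y : Fin (n + 1) → M) :=
    fun {n a b} hb x => (type_iff hb (UpTo.of (φ_e (n + 1) (Fin.snoc a x))).e_ex).1 ⟨x, φ_self _⟩
  refine ⟨φ n a, φ_e n a, Set.ext fun b => ⟨fun hb => ?_, fun hb => ?_⟩⟩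
  · refine exists_equiv_of_backAndForth (fun n a b => (φ n a).Realize b)
      (fun h _ hψ => type_iff h (hψ.upTo_e (φ_e n a).one_le)) forth ?_ hb
    intro n a b h y
    obtain ⟨x, hx⟩ := forth (φ_symm h) y
    exact ⟨x, φ_symm hx⟩
  · exact (realize_of_mem_autOrbit hb _).2 (φ_self a)

/-- On a fixed countable structure, every `𝔈_α` formula agrees with a `Σ_α` formula.  An `𝔄̄_β`
formula with `β < α` is equivalent there to the disjunction, over the tuples satisfying it, of `Π_β`
formulas that imply it. -/
theorem IsE.exists_sigma [Countable M] (α : Ordinal.{0}) :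
    ∀ {n : ℕ} {φ : InfFormula L n}, IsE α φ → ∃ ψ : InfFormula L n,
      UpTo.{u, v, w} (IsSigma α) ψ ∧ ∀ b : Fin n → M, φ.Realize b ↔ ψ.Realize b := by
  induction α using WellFoundedLT.induction with
  | ind α ih =>
    intro n φ h
    have hα := h.one_le
    refine IsE.induction (motive := fun {n} φ => ∃ ψ : InfFormula L n,
      UpTo.{u, v, w} (IsSigma α) ψ ∧ ∀ b : Fin n → M, φ.Realize b ↔ ψ.Realize b) ?_ ?_ ?_ ?_ h
    · exact fun _ h => ⟨_, h.upTo_sigma α, fun _ => Iff.rfl⟩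
    · intro β n φ hβ h
      have hβ₁ := h.one_le
      have key : ∀ a : Fin n → M, φ.Realize a → ∃ ψ : InfFormula L n, UpTo.{u, v, w} (IsPi β) ψ ∧
          ψ.Realize a ∧ ∀ b : Fin n → M, ψ.Realize b → φ.Realize b := by
        refine IsABar.induction (motive := fun {n} φ => ∀ a : Fin n → M, φ.Realize a →
          ∃ ψ : InfFormula L n, UpTo.{u, v, w} (IsPi β) ψ ∧ ψ.Realize a ∧
            ∀ b : Fin n → M, ψ.Realize b → φ.Realize b) ?_ ?_ ?_ h
        · intro n φ h a ha
          obtain ⟨χ, hχ, e⟩ := UpTo.neg_a (.of h)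
          obtain ⟨ψ, hψ, e'⟩ := ih β hβ hχ
          have : ∀ b : Fin n → M, ψ.neg.Realize b ↔ φ.Realize b := fun b => by
            rw [realize_neg, ← e', ← e, realize_neg, not_not]
          exact ⟨ψ.neg, hψ.neg_sigma, (this a).2 ha, fun b => (this b).1⟩
        · rintro n φ h a ⟨i, ha⟩
          obtain ⟨ψ, hψ, ha, h⟩ := h i a ha
          exact ⟨ψ, hψ, ha, fun b hb => ⟨i, h b hb⟩⟩
        · intro n φ h a ha
          choose ψ hψ ha h using fun i => h i a (ha i)
          exact ⟨iInf ψ, UpTo.pi_iInf hβ₁ hψ, ha, fun b hb i => h i b (hb i)⟩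
      choose ψ hψ ha h using key
      refine ⟨disj fun a : {a : Fin n → M // φ.Realize a} => ψ a.1 a.2,
        UpTo.sigma_disj hα fun a => (hψ a.1 a.2).sigma_of_pi_lt hβ, fun b => ?_⟩
      rw [realize_disj]
      exact ⟨fun hb => ⟨⟨b, hb⟩, ha b hb⟩, fun ⟨a, hb⟩ => h _ _ b hb⟩
    · rintro n φ ⟨ψ, hψ, e⟩
      exact ⟨ψ.ex, UpTo.sigma_ex hα hψ, fun b => by simp [Realize, e]⟩
    · intro n φ h
      choose ψ hψ e using h
      exact ⟨InfFormula.iSup ψ, UpTo.sigma_iSup hα hψ, fun b => by simp [Realize, e]⟩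

/-! ### Scott sentences -/

theorem IsScottSentence.congr {φ ψ : InfFormula L 0} (h : φ.IsScottSentence M)
    (e : ∀ (N : Type w) [L.Structure N] (b : Fin 0 → N), φ.Realize b ↔ ψ.Realize b) :
    ψ.IsScottSentence M :=
  fun N _ _ => (e N _).symm.trans (h N)

/-- An implication between `Σ_α` formulas is equivalent to a `Π_{α+1}` formula, as the existential
quantifiers in its antecedent become universal quantifiers in front. -/
theorem UpTo.pi_imp (hα : 1 ≤ α) {φ χ : InfFormula L n} (hφ : UpTo.{u, v, w} (IsSigma α) φ)
    (hχ : UpTo.{u, v, w} (IsSigma α) χ) : UpTo.{u, v, w} (IsPi (α + 1)) (imp φ χ) := by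
  obtain ⟨φ, hφ, e⟩ := hφ
  cases hφ with
  | qf h => simp at hα
  | iSup_exs k ψ β hβ h =>
    refine UpTo.congr (UpTo.iInf_alls (k := k)
      (ψ := fun i => imp (ψ i) (χ.rename (Fin.castAdd (k i))))
      fun i => ⟨α, lt_add_one α, ?_⟩) fun N _ b => ?_
    · refine (UpTo.sigma_iSup (φ := fun j => if j = 0 then (ψ i).neg else
        χ.rename (Fin.castAdd (k i))) hα fun j => ?_).congr fun N _ b => ?_
      · split_ifs
        · exact (UpTo.neg_pi (.of (h i))).mono_sigma (hβ i).le
        · exact hχ.rename_sigma _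
      · simp only [Realize]
        constructor
        · intro himp
          by_cases hψ : (ψ i).Realize b
          · exact ⟨1, himp hψ⟩
          · exact ⟨0, hψ⟩
        · rintro ⟨j, hj⟩ hψ
          split_ifs at hj
          · exact (hj hψ).elim
          · exact hj
    · simp only [Realize, e, realize_exs, realize_alls, realize_rename, Fin.append_left]
      exact ⟨fun h i y hy => h ⟨i, y, hy⟩, fun h ⟨i, y, hy⟩ => h i y hy⟩

/-- The universal closure of a formula. -/
def closure (φ : InfFormula L n) : InfFormula L 0 := alls n (φ.rename (Fin.natAdd 0))

theorem realize_closure {N : Type w} [L.Structure N] (φ : InfFormula L n) (b : Fin 0 → N) :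
    φ.closure.Realize b ↔ ∀ c : Fin n → N, φ.Realize c := by
  simp only [closure, realize_alls, realize_rename, Fin.append_right]

theorem UpTo.pi_closure (hα : 1 ≤ α) {φ : InfFormula L n} (h : UpTo.{u, v, w} (IsPi α) φ) :
    UpTo.{u, v, w} (IsPi α) φ.closure :=
  alls_induction (motive := fun φ => UpTo.{u, v, w} (IsPi α) φ) (UpTo.pi_all hα) _ (h.rename_pi _)

variable (L n) in
/-- The atomic formulas in `n` variables. -/
abbrev AtomIndex : Type v := (Fin n × Fin n) ⊕ (Σ R : (Σ k, L.Relations k), Fin R.1 → Fin n)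

/-- The atomic formula with a given index. -/
def atom : AtomIndex L n → InfFormula L n
  | .inl p => equal p.1 p.2
  | .inr s => rel s.1.2 s.2

theorem isQF_atom (s : AtomIndex L n) : IsQF (atom s) := by
  rcases s with p | s
  exacts [.equal _ _, .rel _ _]

theorem IsQF.realize_iff {N : Type w} [L.Structure N] {a : Fin n → M} {b : Fin n → N}
    (h : ∀ s : AtomIndex L n, (atom s).Realize a ↔ (atom s).Realize b) {φ : InfFormula L n}
    (hφ : IsQF φ) : φ.Realize a ↔ φ.Realize b := by
  induction hφ with
  | falsum => exact Iff.rfl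
  | equal i j => exact h (.inl (i, j))
  | rel R t => exact h (.inr ⟨⟨_, R⟩, t⟩)
  | imp _ _ h₁ h₂ => exact imp_congr h₁ h₂

/-- If the orbits of all tuples are defined by `Σ_α` formulas, then there is a `Π_{α+1}` Scott
sentence.  It expresses that the pairs of a tuple of `M` and a tuple satisfying the formula of its
orbit form a back-and-forth system. -/
theorem exists_isPi_isScottSentence [L.IsRelational] [Countable (Σ k, L.Relations k)] [Countable M]
    (hα : 1 ≤ α) (h : ∀ (n : ℕ) (a : Fin n → M), ∃ φ : InfFormula L n,
      UpTo.{u, v, w} (IsSigma α) φ ∧ φ.definedSet M = autOrbit L a) :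
    ∃ φ : InfFormula L 0, IsPi (α + 1) φ ∧ φ.IsScottSentence M := by
  classical
  choose φ φ_sigma φ_orbit using h
  have realize_φ : ∀ {n} {a b : Fin n → M}, (φ n a).Realize b ↔ b ∈ autOrbit L a :=
    fun {n a b} => by rw [← φ_orbit n a]; rfl
  let diagram : (p : Σ n, Fin n → M) → AtomIndex L p.1 → InfFormula L p.1 := fun p s =>
    if (atom s).Realize p.2 then atom s else (atom s).neg
  have diagram_qf : ∀ p s, IsQF (diagram p s) := fun p s => by
    dsimp only [diagram]
    split_ifs
    exacts [isQF_atom s, (isQF_atom s).neg]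
  have realize_diagram : ∀ (p s) {N : Type w} [L.Structure N] (b : Fin p.1 → N),
      (diagram p s).Realize b ↔ ((atom s).Realize p.2 ↔ (atom s).Realize b) := by
    intro p s N _ b
    dsimp only [diagram]
    split_ifs with hs <;> simp [hs]
  let atomic : (Σ n, Fin n → M) → InfFormula L 0 := fun p =>
    closure (conj fun s => imp (φ p.1 p.2) (diagram p s))
  let back : (Σ n, Fin n → M) → InfFormula L 0 := fun p =>
    closure (all (imp ((φ p.1 p.2).rename Fin.castSucc)
      (disj fun x : M => φ (p.1 + 1) (Fin.snoc p.2 x))))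
  let forth : (Σ n, Fin n → M) → InfFormula L 0 := fun p =>
    closure (conj fun x : M => imp (φ p.1 p.2) (ex (φ (p.1 + 1) (Fin.snoc p.2 x))))
  let T : InfFormula L 0 := (φ 0 Fin.elim0).and ((conj atomic).and ((conj back).and (conj forth)))
  have hα' : 1 ≤ α + 1 := hα.trans (lt_add_one α).le
  have and_pi : ∀ {φ ψ : InfFormula L 0}, UpTo.{u, v, w} (IsPi (α + 1)) φ →
      UpTo.{u, v, w} (IsPi (α + 1)) ψ → UpTo.{u, v, w} (IsPi (α + 1)) (φ.and ψ) :=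
    fun hφ hψ => UpTo.pi_iInf hα' fun i => by split_ifs; exacts [hφ, hψ]
  have T_pi : UpTo.{u, v, w} (IsPi (α + 1)) T := by
    refine and_pi ((φ_sigma 0 _).pi_of_sigma_lt (lt_add_one α)) (and_pi ?_ (and_pi ?_ ?_)) <;>
      refine UpTo.pi_conj hα' fun p => UpTo.pi_closure hα' ?_
    · exact UpTo.pi_conj hα' fun s =>
        UpTo.pi_imp hα (φ_sigma _ _) ((diagram_qf p s).upTo_sigma α)
    · exact UpTo.pi_all hα' (UpTo.pi_imp hα ((φ_sigma _ _).rename_sigma _)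
        (UpTo.sigma_disj hα fun x => φ_sigma _ _))
    · exact UpTo.pi_conj hα' fun x =>
        UpTo.pi_imp hα (φ_sigma _ _) (UpTo.sigma_ex hα (φ_sigma _ _))
  have realize_T : ∀ (N : Type w) [L.Structure N], T.Realize (Fin.elim0 : Fin 0 → N) ↔
      (φ 0 Fin.elim0).Realize (Fin.elim0 : Fin 0 → N) ∧
      ∀ (n : ℕ) (a : Fin n → M) (b : Fin n → N), (φ n a).Realize b →
        (∀ s : AtomIndex L n, (atom s).Realize a ↔ (atom s).Realize b) ∧
        (∀ y, ∃ x, (φ (n + 1) (Fin.snoc a x)).Realize (Fin.snoc b y : Fin (n + 1) → N)) ∧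
        ∀ x, ∃ y, (φ (n + 1) (Fin.snoc a x)).Realize (Fin.snoc b y : Fin (n + 1) → N) := by
    intro N _
    simp only [T, atomic, back, forth, realize_and, realize_conj, realize_closure, Realize,
      realize_rename, realize_disj, realize_diagram, Sigma.forall, Fin.snoc_castSucc]
    exact and_congr_right fun _ => ⟨fun ⟨h₁, h₂, h₃⟩ n a b hb =>
      ⟨fun s => h₁ n a b s hb, fun y => h₂ n a b y hb, fun x => h₃ n a b x hb⟩,
      fun h => ⟨fun n a b s hb => (h n a b hb).1 s, fun n a b y hb => (h n a b hb).2.1 y,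
        fun n a b x hb => (h n a b hb).2.2 x⟩⟩
  have T_scott : T.IsScottSentence M := by
    intro N _ _
    constructor
    · rw [realize_T]
      rintro ⟨h₀, h⟩
      obtain ⟨f, -⟩ := exists_equiv_of_backAndForth (fun n a b => (φ n a).Realize b)
        (fun hb _ hψ => hψ.realize_iff (h _ _ _ hb).1) (fun hb => (h _ _ _ hb).2.2)
        (fun hb => (h _ _ _ hb).2.1) h₀
      exact ⟨f.symm⟩
    · rintro ⟨g⟩
      rw [← realize_equiv T g, Subsingleton.elim (fun i => g (Fin.elim0 i)) Fin.elim0, realize_T]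
      refine ⟨realize_φ.2 (mem_autOrbit_self _), fun n a b hb => ?_⟩
      obtain ⟨f, rfl⟩ := realize_φ.1 hb
      refine ⟨fun s => (realize_equiv _ f a).symm, fun y => ⟨f.symm y, ?_⟩, fun x => ⟨f x, ?_⟩⟩
      · exact realize_φ.2 ⟨f, by simp [Fin.comp_snoc]⟩
      · exact realize_φ.2 ⟨f, by simp [Fin.comp_snoc]⟩
  obtain ⟨ψ, hψ, e⟩ := T_pi
  exact ⟨ψ, hψ, T_scott.congr e⟩

theorem scottRank_le_iff : scottRank L M ≤ (α : WithTop Ordinal.{0}) ↔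
    ∃ φ : InfFormula L 0, φ.IsPi (α + 1) ∧ φ.IsScottSentence M := by
  constructor
  · intro h
    by_contra hc
    -- the infimum is over well-ordered values, so it is greater than `α` if all of them are
    have : ((α + 1 : Ordinal.{0}) : WithTop Ordinal.{0}) ≤ scottRank L M := by
      refine le_iInf₂ fun β ⟨φ, hφ, hM⟩ => WithTop.coe_le_coe.2 (Order.add_one_le_of_lt ?_)
      by_contra hβ
      exact hc ⟨φ, hφ.mono_succ (not_lt.1 hβ), hM⟩
    exact (lt_add_one α).not_ge (WithTop.coe_le_coe.1 (this.trans h))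
  · exact fun h => iInf₂_le α h

end InfFormula

theorem theorem6p5 {L : FirstOrder.Language.{u, v}} [L.IsRelational] [Countable (Σ k, L.Relations k)]
    (M : Type w) [L.Structure M] [Countable M]
    (α : Ordinal.{0}) (hα : 1 ≤ α) (hα' : α < Ordinal.omega 1) :
    List.TFAE [
      ∃ φ : InfFormula L 0, φ.IsForallE α ∧ φ.IsScottSentence M,
      ∀ (n : ℕ) (a : Fin n → M), ∃ φ : InfFormula L n,
        φ.IsE α ∧ φ.Supports M (InfFormula.typeA α a),
      ∀ (n : ℕ) (a : Fin n → M), ∃ φ : InfFormula L n,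
        φ.IsE α ∧ φ.definedSet M = autOrbit L a,
      ∃ φ : InfFormula L 0, φ.IsPi (α + 1) ∧ φ.IsScottSentence M,
      scottRank L M ≤ (α : WithTop Ordinal.{0})] := by
  tfae_have 1 → 2 := fun ⟨T, hT, hM⟩ n a => hM.exists_supports hα hT a
  tfae_have 2 → 3 := fun h n a => InfFormula.exists_definedSet_eq_autOrbit h a
  tfae_have 3 → 4 := fun h => InfFormula.exists_isPi_isScottSentence hα fun n a => by
    obtain ⟨φ, hφ, e⟩ := h n a
    obtain ⟨ψ, hψ, e'⟩ := InfFormula.IsE.exists_sigma (M := M) α hφ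
    exact ⟨ψ, hψ, e ▸ Set.ext fun b => (e' b).symm⟩
  tfae_have 4 → 1 := fun ⟨φ, hφ, hM⟩ => by
    obtain ⟨ψ, hψ, e⟩ := InfFormula.IsPi.upTo_forallE.{u, v, w} hφ hα
    exact ⟨ψ, hψ, hM.congr e⟩
  tfae_have 4 ↔ 5 := InfFormula.scottRank_le_iff.symm
  tfae_finish
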